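/- **Conventions.** Let $N\ge 1$, $\boldsymbol s=(s_1,\dots,s_N)\in\mathbb Z^N$, and let $\boldsymbol t=\{t_{\alpha,n}\}$, $\bar{\boldsymbol t}=\{\bar t_{\alpha,n}\}$ ($1\le\alpha\le N$, $n\ge1$) be two families of times. Functions of the times are formal power series in $\boldsymbol t,\bar{\boldsymbol t}$ with complex coefficients, and they depend on $\boldsymbol s$ in an arbitrary way. Let $[1]_\alpha$ be the $\alpha$-th standard basis vector of $\mathbb Z^N$ and $\boldsymbol 1=(1,\dots,1)$; $e^{\partial_{s_\alpha}}$ is the shift $\boldsymbol s\mapsto \boldsymbol s+[1]_\alpha$, $e^{\partial_s}$ is the shift $\boldsymbol s\mapsto\boldsymbol s+\boldsymbol 1$, $1_N$ is the unit $N\times N$ matrix, $E_\alpha$ is the diagonal matrix unit. For $A=\sum_j a_j(\boldsymbol s)e^{j\partial_s}$ put $A_{\ge0}=\sum_{j\ge0}a_je^{j\partial_s}$, $A_{<0}=\sum_{j<0}a_je^{j\partial_s}$. **The hierarchy.** A solution of the $N$-component Toda lattice hierarchy consists of $N\times N$-matrix difference operators $$\boldsymbol L=\sum_{j\ge0}b_j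 e^{(1-j)\partial_s},\quad \bar{\boldsymbol L}=\sum_{j\ge0}\bar b_j e^{(j-1)\partial_s},\quad \boldsymbol U_\alpha=\sum_{j\ge0}u_{\alpha,j}e^{-j\partial_s},\quad \bar{\boldsymbol U}_\alpha=\sum_{j\ge0}\bar u_{\alpha,j}e^{j\partial_s},$$ $$\boldsymbol Q_\alpha=e^{-\partial_{s_\alpha}}\sum_{j\ge0}p_{\alpha,j}e^{-j\partial_s},\qquad \bar{\boldsymbol Q}_\alpha=e^{-\partial_{s_\alpha}}\sum_{j\ge0}\bar p_{\alpha,j}e^{j\partial_s},$$ with $b_0=p_{\alpha,0}=1_N$, $u_{\alpha,0}=E_\alpha$, $\bar b_0$ invertible, such that: (a) $\boldsymbol L$ commutes with all $\boldsymbol U_\alpha$ and $\boldsymbol Q_\alpha$, the $\boldsymbol Q_\alpha$ commute with each other and with all $\boldsymbol U_\beta$, $\boldsymbol U_\alpha\boldsymbol U_\beta=\delta_{\alpha\beta}\boldsymbol U_\beta$, $\sum_\alpha\boldsymbol U_\alpha=1_N$, $\prod_\alpha\boldsymbol Q_\alpha=\boldsymbol L^{-1}$; (b) the same holds for the operators with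 a bar, except that $\prod_\alpha\bar{\boldsymbol Q}_\alpha=\bar{\boldsymbol L}$; (c) $\boldsymbol Q_\alpha\sum_\beta\boldsymbol U_\beta\boldsymbol L^{\delta_{\alpha\beta}}=\bar{\boldsymbol Q}_\alpha\sum_\beta\bar{\boldsymbol U}_\beta\bar{\boldsymbol L}^{-\delta_{\alpha\beta}}$ for all $\alpha$; (d) with $\boldsymbol B_{\alpha,n}=(\boldsymbol L^n\boldsymbol U_\alpha)_{\ge0}$, $\bar{\boldsymbol B}_{\alpha,n}=(\bar{\boldsymbol L}^n\bar{\boldsymbol U}_\alpha)_{<0}$, every $\boldsymbol A$ among $\boldsymbol L,\bar{\boldsymbol L},\boldsymbol U_\beta,\bar{\boldsymbol U}_\beta,\boldsymbol Q_\beta,\bar{\boldsymbol Q}_\beta$ satisfies $\partial_{t_{\alpha,n}}\boldsymbol A=[\boldsymbol B_{\alpha,n},\boldsymbol A]$ and $\partial_{\bar t_{\alpha,n}}\boldsymbol A=[\bar{\boldsymbol B}_{\alpha,n},\boldsymbol A]$. **Wave functions.** Wave operators of the solution are $\hat{\boldsymbol W}=\sum_{j\ge0}w_je^{-j\partial_s}$,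 $w_0=1_N$, and $\hat{\bar{\boldsymbol W}}=\sum_{j\ge0}\bar w_je^{j\partial_s}$, $\bar w_0$ invertible, with $$\boldsymbol L\hat{\boldsymbol W}=\hat{\boldsymbol W}e^{\partial_s},\quad \boldsymbol U_\alpha\hat{\boldsymbol W}=\hat{\boldsymbol W}E_\alpha,\quad \boldsymbol Q_\alpha\hat{\boldsymbol W}=\hat{\boldsymbol W}e^{-\partial_{s_\alpha}},\quad \bar{\boldsymbol L}\hat{\bar{\boldsymbol W}}=\hat{\bar{\boldsymbol W}}e^{-\partial_s},\quad \bar{\boldsymbol U}_\alpha\hat{\bar{\boldsymbol W}}=\hat{\bar{\boldsymbol W}}E_\alpha,\quad \bar{\boldsymbol Q}_\alpha\hat{\bar{\boldsymbol W}}=\hat{\bar{\boldsymbol W}}e^{-\partial_{s_\alpha}},$$ $$\partial_{t_{\alpha,n}}\hat{\boldsymbol W}=\boldsymbol B_{\alpha,n}\hat{\boldsymbol W}-\hat{\boldsymbol W}e^{n\partial_s}E_\alpha,\quad \partial_{\bar t_{\alpha,n}}\hat{\boldsymbol W}=\bar{\boldsymbol B}_{\alpha,n}\hat{\boldsymbol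 W},\quad \partial_{t_{\alpha,n}}\hat{\bar{\boldsymbol W}}=\boldsymbol B_{\alpha,n}\hat{\bar{\boldsymbol W}},\quad \partial_{\bar t_{\alpha,n}}\hat{\bar{\boldsymbol W}}=\bar{\boldsymbol B}_{\alpha,n}\hat{\bar{\boldsymbol W}}-\hat{\bar{\boldsymbol W}}e^{-n\partial_s}E_\alpha .$$ Write $\hat{\boldsymbol W}^{-1}=\sum_{j\ge0}e^{-j\partial_s}w^*_j(\boldsymbol s+\boldsymbol 1)$, $\hat{\bar{\boldsymbol W}}^{-1}=\sum_{j\ge0}e^{j\partial_s}\bar w^*_j(\boldsymbol s+\boldsymbol 1)$ and $\xi(\boldsymbol t_\gamma,z)=\sum_{k\ge1}t_{\gamma,k}z^k$. The wave functions and adjoint wave functions are $$\Psi_{\alpha\beta}(z)=z^{s_\beta}e^{\xi(\boldsymbol t_\beta,z)}\sum_{j\ge0}w_{j,\alpha\beta}z^{-j},\qquad \Psi^*_{\alpha\beta}(z)=z^{-s_\alpha}e^{-\xi(\boldsymbol t_\alpha,z)}\sum_{j\ge0}w^*_{j,\alpha\beta}z^{-j},$$ $$\bar\Psi_{\alpha\beta}(z^{-1})=z^{-s_\beta}e^{\xi(\bar{\boldsymbol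 t}_\beta,z)}\sum_{j\ge0}\bar w_{j,\alpha\beta}z^{-j},\qquad \bar\Psi^*_{\alpha\beta}(z^{-1})=z^{s_\alpha}e^{-\xi(\bar{\boldsymbol t}_\alpha,z)}\sum_{j\ge0}\bar w^*_{j,\alpha\beta}z^{-j}.$$ **Tau-function.** Let $\boldsymbol t\pm[z^{-1}]_\gamma$ be $\boldsymbol t$ with $t_{\gamma,k}$ replaced by $t_{\gamma,k}\pm z^{-k}/k$ for all $k\ge1$. A tau-function is a matrix $(\tau_{\alpha\beta}(\boldsymbol s,\boldsymbol t,\bar{\boldsymbol t}))_{\alpha,\beta=1}^N$ whose diagonal elements all equal one function $\tau$, not identically zero for any $\boldsymbol s$, such that $$\Psi_{\alpha\beta}(\boldsymbol s,\boldsymbol t,\bar{\boldsymbol t};z)=z^{s_\beta+\delta_{\alpha\beta}-1}e^{\xi(\boldsymbol t_\beta,z)}\frac{\tau_{\alpha\beta}(\boldsymbol s,\boldsymbol t-[z^{-1}]_\beta,\bar{\boldsymbol t})}{\tau(\boldsymbol s,\boldsymbol t,\bar{\boldsymbol t})},$$ $$\Psi^*_{\alpha\beta}(\boldsymbol s,\boldsymbol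 t,\bar{\boldsymbol t};z)=(-1)^{\delta_{\alpha\beta}-1}z^{-s_\alpha+\delta_{\alpha\beta}-1}e^{-\xi(\boldsymbol t_\alpha,z)}\frac{\tau_{\alpha\beta}(\boldsymbol s,\boldsymbol t+[z^{-1}]_\alpha,\bar{\boldsymbol t})}{\tau(\boldsymbol s,\boldsymbol t,\bar{\boldsymbol t})},$$ $$\bar\Psi_{\alpha\beta}(\boldsymbol s,\boldsymbol t,\bar{\boldsymbol t};z^{-1})=(-1)^{\delta_{\alpha\beta}-1}z^{-s_\beta}e^{\xi(\bar{\boldsymbol t}_\beta,z)}\frac{\tau_{\alpha\beta}(\boldsymbol s+[1]_\beta,\boldsymbol t,\bar{\boldsymbol t}-[z^{-1}]_\beta)}{\tau(\boldsymbol s,\boldsymbol t,\bar{\boldsymbol t})},$$ $$\bar\Psi^*_{\alpha\beta}(\boldsymbol s,\boldsymbol t,\bar{\boldsymbol t};z^{-1})=z^{s_\alpha}e^{-\xi(\bar{\boldsymbol t}_\alpha,z)}\frac{\tau_{\alpha\beta}(\boldsymbol s-[1]_\alpha,\boldsymbol t,\bar{\boldsymbol t}+[z^{-1}]_\alpha)}{\tau(\boldsymbol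 s,\boldsymbol t,\bar{\boldsymbol t})}.$$ **Theorem.** Every tau-function of the $N$-component Toda lattice hierarchy satisfies, for all $\alpha,\beta\in\{1,\dots,N\}$ and all $\boldsymbol s,\boldsymbol t,\bar{\boldsymbol t},\boldsymbol s',\boldsymbol t',\bar{\boldsymbol t}'$, $$\sum_{\gamma=1}^N(-1)^{\delta_{\beta\gamma}}\oint_{C_\infty}z^{s_\gamma-s'_\gamma+\delta_{\alpha\gamma}+\delta_{\beta\gamma}-2}e^{\xi(\boldsymbol t_\gamma-\boldsymbol t'_\gamma,z)}\,\tau_{\alpha\gamma}(\boldsymbol s,\boldsymbol t-[z^{-1}]_\gamma,\bar{\boldsymbol t})\,\tau_{\gamma\beta}(\boldsymbol s',\boldsymbol t'+[z^{-1}]_\gamma,\bar{\boldsymbol t}')\,dz$$ $$=\sum_{\gamma=1}^N(-1)^{\delta_{\alpha\gamma}}\oint_{C_\infty}z^{s'_\gamma-s_\gamma-2}e^{\xi(\bar{\boldsymbol t}_\gamma-\bar{\boldsymbol t}'_\gamma,z)}\,\tau_{\alpha\gamma}(\boldsymbol s+[1]_\gamma,\boldsymbol t,\bar{\boldsymbol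 t}-[z^{-1}]_\gamma)\,\tau_{\gamma\beta}(\boldsymbol s'-[1]_\gamma,\boldsymbol t',\bar{\boldsymbol t}'+[z^{-1}]_\gamma)\,dz .$$ This is an identity for all $\boldsymbol s,\boldsymbol s'\in\mathbb Z^N$ between formal power series in the independent variables $\boldsymbol t,\bar{\boldsymbol t},\boldsymbol t',\bar{\boldsymbol t}'$; the coefficient of every monomial in the integrand is a Laurent series in $z^{-1}$, and $\oint_{C_\infty}f(z)\,dz$ is $2\pi i$ times the coefficient of $z^{-1}$ in $f$. -/

import Mathlib

open MvPowerSeries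

noncomputable section

namespace Toda

/-! ## Times and functions of the times

All functions of the continuous times are formal power series in the times with complex
coefficients; they also depend on the discrete variable in the lattice of integer vectors. -/

/-- The discrete variable `s = (s_1, …, s_N)`. -/
abbrev Lat (N : ℕ) := Fin N → ℤ

/-- The vector `[1]_α`. -/
abbrev unitVec {N : ℕ} (α : Fin N) : Lat N := Pi.single α 1

/-- Index set of the continuous times: `(Sum.inl α, n)` is the index of `t_{α,n}` and
`(Sum.inr α, n)` is the index of the time `t_{α,n}` with a bar, `n = 1, 2, 3, …`. -/
abbrev Times (N : ℕ) := (Fin N ⊕ Fin N) × ℕ+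

/-- Functions of the times. -/
abbrev Fn (N : ℕ) := MvPowerSeries (Times N) ℂ

/-- Matrix valued functions of the times. -/
abbrev Mat (N : ℕ) := Matrix (Fin N) (Fin N) (Fn N)

/-- The diagonal matrix unit `E_α`. -/
def diagUnit {N : ℕ} (α : Fin N) : Mat N := Matrix.single α α 1

/-! ## Matrix difference operators -/

/-- Formal matrix difference operators `A = ∑_v a_v(s) e^{v·∂_s}`, where `v` runs over all
integer vectors; the coefficient `a_v(s)` is `A v s`.  In particular the total shift
`e^{j ∂_s}` is the one with `v = (j, …, j)`. -/
def DiffOp (N : ℕ) := Lat N → Lat N → Mat N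

namespace DiffOp

variable {N : ℕ}

instance : AddCommGroup (DiffOp N) := inferInstanceAs (AddCommGroup (Lat N → Lat N → Mat N))

/-- Composition: `a(s) e^{u·∂} ∘ b(s) e^{w·∂} = a(s) b(s+u) e^{(u+w)·∂}`. For all products that
occur below and `N ≥ 1`, only finitely many `u` contribute to each coefficient. -/
instance : Mul (DiffOp N) := ⟨fun A B v s => ∑ᶠ u : Lat N, A u s * B (v - u) (s + u)⟩

/-- Multiplication by the constant matrix `M`. -/
def ofMat (M : Mat N) : DiffOp N := fun v _ => if v = 0 then M else 0

instance : One (DiffOp N) := ⟨ofMat 1⟩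

/-- The shift operator `e^{u·∂_s}`. -/
def shiftOp (u : Lat N) : DiffOp N := fun v _ => if v = u then 1 else 0

/-- The vector `(k, …, k)`. -/
def diagVec (N : ℕ) (k : ℤ) : Lat N := fun _ => k

/-- The operator `∑_{j ≥ 0} c_j(s) e^{(k-j)∂_s}`. -/
def lower (k : ℤ) (c : ℕ → Lat N → Mat N) : DiffOp N :=
  fun v s => ∑ᶠ j : ℕ, if v = diagVec N (k - j) then c j s else 0

/-- The operator `∑_{j ≥ 0} c_j(s) e^{(k+j)∂_s}`. -/
def upper (k : ℤ) (c : ℕ → Lat N → Mat N) : DiffOp N :=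
  fun v s => ∑ᶠ j : ℕ, if v = diagVec N (k + j) then c j s else 0

/-- The power `A^n`. -/
def npow (A : DiffOp N) : ℕ → DiffOp N
  | 0 => 1
  | n + 1 => npow A n * A

/-- The part `A_{≥ 0}` with non-negative shifts. -/
def geZeroPart (A : DiffOp N) : DiffOp N :=
  fun v s => by classical exact if ∃ j : ℕ, v = diagVec N j then A v s else 0

/-- The part `A_{< 0}` with negative shifts. -/
def ltZeroPart (A : DiffOp N) : DiffOp N :=
  fun v s => by classical exact if ∃ j : ℕ, v = diagVec N (-(j + 1)) then A v s else 0

/-- The derivative of all coefficients with respect to the time with index `i`. -/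
def tderiv (i : Times N) (A : DiffOp N) : DiffOp N :=
  fun v s => (A v s).map (pderiv ℂ i)

/-- The commutator `[A, B]`. -/
def bracket (A B : DiffOp N) : DiffOp N := A * B - B * A

/-- `B` is a two-sided inverse of `A`. -/
def IsInverse (A B : DiffOp N) : Prop := A * B = 1 ∧ B * A = 1

end DiffOp

open DiffOp

/-! ## The hierarchy in the Lax form -/

/-- The coefficients `b_j`, `u_{α,j}`, `p_{α,j}` (and those with a bar) of the operators of the
Lax formalism. -/
structure LaxData (N : ℕ) where
  b : ℕ → Lat N → Mat N
  bbar : ℕ → Lat N → Mat N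
  u : Fin N → ℕ → Lat N → Mat N
  ubar : Fin N → ℕ → Lat N → Mat N
  p : Fin N → ℕ → Lat N → Mat N
  pbar : Fin N → ℕ → Lat N → Mat N

namespace LaxData

variable {N : ℕ} (D : LaxData N)

/-- `L = ∑ b_j e^{(1-j)∂}`. -/
def L : DiffOp N := lower 1 D.b

/-- `L̄ = ∑ b̄_j e^{(j-1)∂}`. -/
def Lbar : DiffOp N := upper (-1) D.bbar

/-- `U_α = ∑ u_{α,j} e^{-j∂}`. -/
def U (α : Fin N) : DiffOp N := lower 0 (D.u α)

/-- `Ū_α = ∑ ū_{α,j} e^{j∂}`. -/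
def Ubar (α : Fin N) : DiffOp N := upper 0 (D.ubar α)

/-- `P_α = ∑ p_{α,j} e^{-j∂}`. -/
def P (α : Fin N) : DiffOp N := lower 0 (D.p α)

/-- `P̄_α = ∑ p̄_{α,j} e^{j∂}`. -/
def Pbar (α : Fin N) : DiffOp N := upper 0 (D.pbar α)

/-- `Q_α = e^{-∂_{s_α}} P_α`. -/
def Q (α : Fin N) : DiffOp N := shiftOp (-unitVec α) * D.P α

/-- `Q̄_α = e^{-∂_{s_α}} P̄_α`. -/
def Qbar (α : Fin N) : DiffOp N := shiftOp (-unitVec α) * D.Pbar α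

/-- `B_{α,n} = (L^n U_α)_{≥ 0}`. -/
def B (α : Fin N) (n : ℕ+) : DiffOp N := geZeroPart (npow D.L n * D.U α)

/-- `B̄_{α,n} = (L̄^n Ū_α)_{< 0}`. -/
def Bbar (α : Fin N) (n : ℕ+) : DiffOp N := ltZeroPart (npow D.Lbar n * D.Ubar α)

/-- The Lax equations for an operator `A`, with respect to all times. -/
def LaxEq (A : DiffOp N) : Prop :=
  ∀ (α : Fin N) (n : ℕ+),
    tderiv (Sum.inl α, n) A = bracket (D.B α n) A ∧ tderiv (Sum.inr α, n) A = bracket (D.Bbar α n) A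

/-- `D` is a solution of the `N`-component Toda lattice hierarchy. -/
structure IsSolution : Prop where
  b_zero : ∀ s, D.b 0 s = 1
  bbar_zero : ∀ s, IsUnit (D.bbar 0 s)
  u_zero : ∀ α s, D.u α 0 s = diagUnit α
  p_zero : ∀ α s, D.p α 0 s = 1
  comm_L_U : ∀ α, bracket D.L (D.U α) = 0
  comm_L_Q : ∀ α, bracket D.L (D.Q α) = 0
  comm_U_Q : ∀ α β, bracket (D.U α) (D.Q β) = 0
  comm_Q_Q : ∀ α β, bracket (D.Q α) (D.Q β) = 0
  U_mul_U : ∀ α β, D.U α * D.U β = if α = β then D.U β else 0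
  sum_U : ∑ α, D.U α = 1
  /-- `∏ Q_α = L⁻¹` -/
  prod_Q : IsInverse D.L (List.ofFn D.Q).prod
  comm_Lbar_Ubar : ∀ α, bracket D.Lbar (D.Ubar α) = 0
  comm_Lbar_Qbar : ∀ α, bracket D.Lbar (D.Qbar α) = 0
  comm_Ubar_Qbar : ∀ α β, bracket (D.Ubar α) (D.Qbar β) = 0
  comm_Qbar_Qbar : ∀ α β, bracket (D.Qbar α) (D.Qbar β) = 0
  Ubar_mul_Ubar : ∀ α β, D.Ubar α * D.Ubar β = if α = β then D.Ubar β else 0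
  sum_Ubar : ∑ α, D.Ubar α = 1
  /-- `∏ Q̄_α = L̄` -/
  prod_Qbar : (List.ofFn D.Qbar).prod = D.Lbar
  /-- `Q_α ∑_β U_β L^{δ_{αβ}} = Q̄_α ∑_β Ū_β L̄^{-δ_{αβ}}`, where the inverse of `L̄` is the
  operator of the form `∑_{j ≥ 0} m_j e^{(1+j)∂}` (it exists and is unique because `b̄_0` is
  invertible). -/
  basis : ∃ m : ℕ → Lat N → Mat N, IsInverse D.Lbar (upper 1 m) ∧
    ∀ α, D.Q α * ∑ β, D.U β * (if α = β then D.L else 1) =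
      D.Qbar α * ∑ β, D.Ubar β * (if α = β then upper 1 m else 1)
  lax_L : D.LaxEq D.L
  lax_Lbar : D.LaxEq D.Lbar
  lax_U : ∀ β, D.LaxEq (D.U β)
  lax_Ubar : ∀ β, D.LaxEq (D.Ubar β)
  lax_Q : ∀ β, D.LaxEq (D.Q β)
  lax_Qbar : ∀ β, D.LaxEq (D.Qbar β)

end LaxData

/-! ## Wave operators -/

/-- The coefficients `w_j`, `w̄_j` of the wave operators and the coefficients `w*_j`, `w̄*_j`
of their inverses. -/
structure WaveData (N : ℕ) where
  w : ℕ → Lat N → Mat N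
  wbar : ℕ → Lat N → Mat N
  wstar : ℕ → Lat N → Mat N
  wbarstar : ℕ → Lat N → Mat N

namespace WaveData

variable {N : ℕ} (W : WaveData N)

/-- `Ŵ = ∑ w_j e^{-j∂}`. -/
def hatW : DiffOp N := lower 0 W.w

/-- `Ŵ` with a bar: `∑ w̄_j e^{j∂}`. -/
def hatWbar : DiffOp N := upper 0 W.wbar

/-- `∑ e^{-j∂} w*_j(s + 𝟏) = ∑ w*_j(s + (1-j)𝟏) e^{-j∂}`. -/
def hatWinv : DiffOp N := lower 0 fun j s => W.wstar j (s + diagVec N (1 - j))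

/-- `∑ e^{j∂} w̄*_j(s + 𝟏) = ∑ w̄*_j(s + (1+j)𝟏) e^{j∂}`. -/
def hatWbarinv : DiffOp N := upper 0 fun j s => W.wbarstar j (s + diagVec N (1 + j))

/-- The operators given by `W` are wave operators of the solution `D`, together with their
inverses. The equations are those for the operators with a hat, that is after the
factors `diag(e^{ξ(t_α, e^∂)})`, `diag(e^{ξ(t̄_α, e^{-∂})})` of the full wave operators have been
split off. -/
structure IsWave (D : LaxData N) : Prop where
  w_zero : ∀ s, W.w 0 s = 1
  wbar_zero : ∀ s, IsUnit (W.wbar 0 s)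
  L_W : D.L * W.hatW = W.hatW * shiftOp (diagVec N 1)
  U_W : ∀ α, D.U α * W.hatW = W.hatW * ofMat (diagUnit α)
  Lbar_Wbar : D.Lbar * W.hatWbar = W.hatWbar * shiftOp (diagVec N (-1))
  Ubar_Wbar : ∀ α, D.Ubar α * W.hatWbar = W.hatWbar * ofMat (diagUnit α)
  Q_W : ∀ α, D.Q α * W.hatW = W.hatW * shiftOp (-unitVec α)
  Qbar_Wbar : ∀ α, D.Qbar α * W.hatWbar = W.hatWbar * shiftOp (-unitVec α)
  deriv_W : ∀ (α : Fin N) (n : ℕ+), tderiv (Sum.inl α, n) W.hatW =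
    D.B α n * W.hatW - W.hatW * (shiftOp (diagVec N n) * ofMat (diagUnit α))
  derivbar_W : ∀ (α : Fin N) (n : ℕ+), tderiv (Sum.inr α, n) W.hatW = D.Bbar α n * W.hatW
  deriv_Wbar : ∀ (α : Fin N) (n : ℕ+), tderiv (Sum.inl α, n) W.hatWbar = D.B α n * W.hatWbar
  derivbar_Wbar : ∀ (α : Fin N) (n : ℕ+), tderiv (Sum.inr α, n) W.hatWbar =
    D.Bbar α n * W.hatWbar - W.hatWbar * (shiftOp (diagVec N (-n)) * ofMat (diagUnit α))
  inv_W : IsInverse W.hatW W.hatWinv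
  inv_Wbar : IsInverse W.hatWbar W.hatWbarinv

end WaveData

/-! ## Functions that depend on the spectral parameter `z` as well -/

/-- Formal power series in the variables `σ` whose coefficients are Laurent series in `z⁻¹`:
the variable of `LaurentSeries ℂ` is `z⁻¹`, so that `z^k` is `HahnSeries.single (-k) 1`. -/
abbrev ZFn (σ : Type) := MvPowerSeries σ (LaurentSeries ℂ)

variable {σ : Type}

/-- A function that does not depend on `z`. -/
def ofFn : MvPowerSeries σ ℂ →+* ZFn σ := MvPowerSeries.map HahnSeries.C

/-- `z^k`. -/
def zpow (k : ℤ) : ZFn σ := MvPowerSeries.C (HahnSeries.single (-k) 1)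

/-- `∑_{j ≥ 0} c_j z^{-j}`. -/
def zSeries (c : ℕ → MvPowerSeries σ ℂ) : ZFn σ := fun m =>
  HahnSeries.ofPowerSeries ℤ ℂ (PowerSeries.mk fun j => MvPowerSeries.coeff m (c j))

/-- `ξ(x, z) = ∑_{k ≥ 1} x_k z^k`. It is used where `x_k` is a time or a difference of two times
of number `k`; then only finitely many `k` contribute to the coefficient of each monomial. -/
def xi (x : ℕ+ → MvPowerSeries σ ℂ) : ZFn σ := fun m =>
  ∑ᶠ k : ℕ+, HahnSeries.single (-(k : ℤ)) (MvPowerSeries.coeff m (x k))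

/-- The exponential of a series without constant term. -/
def expZ (f : ZFn σ) : ZFn σ := PowerSeries.subst f (PowerSeries.exp ℂ)

/-- `∮ f(z) dz` over a contour around `∞`: the coefficient of `z⁻¹`, times `2πi`. -/
def oint (f : ZFn σ) : MvPowerSeries σ ℂ := fun m =>
  2 * Real.pi * Complex.I * (MvPowerSeries.coeff m f).coeff 1

/-- The substitution `t_{φ,k} ↦ t_{φ,k} + ε z^{-k} / k` for `k = 1, 2, 3, …`, all other times
being left alone; the additional variable `none` stands for `z⁻¹`. -/
def shiftVar {N : ℕ} (ε : ℂ) (φ : Fin N ⊕ Fin N) (i : Times N) :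
    MvPowerSeries (Option (Times N)) ℂ :=
  X (some i) + if i.1 = φ then MvPowerSeries.C (ε / (i.2 : ℕ)) * X none ^ (i.2 : ℕ) else 0

/-- The substitution is admissible for formal power series. -/
theorem hasSubst_shiftVar {N : ℕ} (ε : ℂ) (φ : Fin N ⊕ Fin N) : HasSubst (shiftVar ε φ) where
  const_coeff i := by
    have : (i.2:ℕ) ≠ 0 := i.2.ne_zero
    simp only [shiftVar]; split_ifs <;> simp [this]
  coeff_zero d := by
    classical
    apply Set.Finite.subset
      (s := (⋃ x ∈ d.support, {i | some i = x}) ∪ {i : Times N | i.1 = φ ∧ (i.2:ℕ) = d none})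
    · apply Set.Finite.union
      · apply Set.Finite.biUnion (Finset.finite_toSet _)
        intro x _
        exact Set.Subsingleton.finite (by intro a ha b hb; simp at ha hb; rw [← hb] at ha; simpa using ha)
      · exact Set.Subsingleton.finite (by
          rintro ⟨a1, a2⟩ ⟨h1, h2⟩ ⟨b1, b2⟩ ⟨h3, h4⟩
          simp at h1 h2 h3 h4
          ext1
          · simp [h1, h3]
          · exact PNat.eq (h2.trans h4.symm))
    · intro i hi
      by_contra hc
      simp only [Set.mem_union, not_or] at hc
      apply hi
      simp only [shiftVar, map_add]
      have h1 : coeff d (X (some i) : MvPowerSeries (Option (Times N)) ℂ) = 0 := by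
        rw [coeff_X, if_neg]
        rintro rfl
        apply hc.1
        simp
      rw [h1]
      split_ifs with h
      · rw [coeff_C_mul, coeff_X_pow, if_neg]
        · simp
        · rintro rfl
          apply hc.2
          simp [h]
      · simp

/-- A series in `σ` and `z⁻¹` (the variable `none`) as a series in `σ` with coefficients which
are series in `z⁻¹`. -/
def collect (F : MvPowerSeries (Option σ) ℂ) : ZFn σ := fun m =>
  HahnSeries.ofPowerSeries ℤ ℂ
    (PowerSeries.mk fun n => MvPowerSeries.coeff (m.mapDomain some + Finsupp.single none n) F)

/-- `f` with the times of the family `φ` shifted by `ε [z⁻¹]`: for `φ = Sum.inl γ` this is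
`f(t + ε [z⁻¹]_γ, t̄)` and for `φ = Sum.inr γ` it is `f(t, t̄ + ε [z⁻¹]_γ)`. -/
def shift {N : ℕ} (ε : ℂ) (φ : Fin N ⊕ Fin N) (f : Fn N) : ZFn (Times N) :=
  collect (MvPowerSeries.subst (shiftVar ε φ) f)

/-- The Kronecker symbol. -/
def kd {N : ℕ} (α β : Fin N) : ℕ := if α = β then 1 else 0

/-! ## Wave functions and the tau-function -/

/-- The time `t_{γ,k}`. -/
def tT {N : ℕ} (γ : Fin N) (k : ℕ+) : Fn N := X (Sum.inl γ, k)

/-- The time `t̄_{γ,k}`. -/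
def tTbar {N : ℕ} (γ : Fin N) (k : ℕ+) : Fn N := X (Sum.inr γ, k)

namespace WaveData

variable {N : ℕ} (W : WaveData N)

/-- `Ψ_{αβ}(s; z)`. -/
def Psi (α β : Fin N) (s : Lat N) : ZFn (Times N) :=
  zSeries (fun j => W.w j s α β) * zpow (s β) * expZ (xi (tT β))

/-- `Ψ*_{αβ}(s; z)`. -/
def PsiStar (α β : Fin N) (s : Lat N) : ZFn (Times N) :=
  zSeries (fun j => W.wstar j s α β) * zpow (-s α) * expZ (-xi (tT α))

/-- `Ψ̄_{αβ}(s; z⁻¹)`. -/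
def PsiBar (α β : Fin N) (s : Lat N) : ZFn (Times N) :=
  zSeries (fun j => W.wbar j s α β) * zpow (-s β) * expZ (xi (tTbar β))

/-- `Ψ̄*_{αβ}(s; z⁻¹)`. -/
def PsiBarStar (α β : Fin N) (s : Lat N) : ZFn (Times N) :=
  zSeries (fun j => W.wbarstar j s α β) * zpow (s α) * expZ (-xi (tTbar α))

/-- `τ` is a tau-function: its diagonal elements are all equal to one function that does not
vanish identically, and the wave functions are expressed through it. The quotients by the
diagonal element are written after multiplication by the denominator (the ring of series is an
integral domain). -/
structure IsTau (τ : Fin N → Fin N → Lat N → Fn N) : Prop where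
  diag : ∀ α β s, τ α α s = τ β β s
  ne_zero : ∀ α s, τ α α s ≠ 0
  psi : ∀ α β s, ofFn (τ α α s) * W.Psi α β s =
    zpow (s β + kd α β - 1) * expZ (xi (tT β)) * shift (-1) (Sum.inl β) (τ α β s)
  psiStar : ∀ α β s, ofFn (τ α α s) * W.PsiStar α β s =
    (-1) ^ (kd α β + 1) * zpow (-s α + kd α β - 1) * expZ (-xi (tT α)) *
      shift 1 (Sum.inl α) (τ α β s)
  psiBar : ∀ α β s, ofFn (τ α α s) * W.PsiBar α β s =
    (-1) ^ (kd α β + 1) * zpow (-s β) * expZ (xi (tTbar β)) *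
      shift (-1) (Sum.inr β) (τ α β (s + unitVec β))
  psiBarStar : ∀ α β s, ofFn (τ α α s) * W.PsiBarStar α β s =
    zpow (s α) * expZ (-xi (tTbar α)) *
      shift 1 (Sum.inr α) (τ α β (s - unitVec α))

end WaveData

/-! ## Two independent sets of times -/

/-- Series in two independent sets of times `(t, t̄)` (variables `Sum.inl i`) and `(t', t̄')`
(variables `Sum.inr i`), and in `z`. -/
abbrev ZFn2 (N : ℕ) := ZFn (Times N ⊕ Times N)

/-- A function of `(t, t̄; z)` as a function of `(t, t̄, t', t̄'; z)`. -/
def inFst {N : ℕ} (f : ZFn (Times N)) : ZFn2 N := MvPowerSeries.rename (Function.Embedding.inl : Times N ↪ Times N ⊕ Times N) f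

/-- The function `f(t', t̄'; z)` as a function of `(t, t̄, t', t̄'; z)`. -/
def inSnd {N : ℕ} (f : ZFn (Times N)) : ZFn2 N := MvPowerSeries.rename (Function.Embedding.inr : Times N ↪ Times N ⊕ Times N) f

/-- `e^{ξ(t_γ - t'_γ, z)}` for `φ = Sum.inl γ`, and `e^{ξ(t̄_γ - t̄'_γ, z)}` for
`φ = Sum.inr γ`. -/
def expXiDiff {N : ℕ} (φ : Fin N ⊕ Fin N) : ZFn2 N :=
  expZ (xi fun k => X (Sum.inl (φ, k)) - X (Sum.inr (φ, k)))

end Toda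

end

noncomputable section

namespace Toda

/-! ### The exponential of a series without constant term -/

section Exponential

variable {σ : Type}

/-! Up to the factor $2\pi i$, the common sign $-1$ and the factor $\tau(s,t,\bar
t)\,\tau(s',t',\bar t')$, the two sides are the residue pairings of $\Psi(s,t)$ with $\Psi^*(s',t')$
and of $\bar\Psi$ with $\bar\Psi^*$ (`WaveData.IsTau.oint_eq`, `WaveData.IsTau.oint_bar_eq`). So it
is enough that the difference of the two pairings, `WaveData.bilinear`, vanishes.

Equal times, $s=s'+k\boldsymbol 1$: the exponentials cancel, and each pairing is a coefficient of
(wave operator)·(its inverse) $=1$. Both equal $\delta_{k,-1}\delta_{\alpha\beta}$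
(`diagonal_pairing`).

Different times, $s=s'+k\boldsymbol 1$: $\Psi$ and $\bar\Psi$ satisfy the same linear equations
$\partial\Psi=B\Psi$, where $B$ has finitely many shifts, all along $\boldsymbol 1$
(`WaveData.IsWave.exists_evolution`). The differences on the line $s'+\mathbb Z\boldsymbol 1$ are
thus a family closed under derivatives in the unprimed times and zero on the diagonal; comparing
coefficients, it is zero (`eq_zero_of_diagonal_eq_zero`).

Arbitrary $s$: the operator in condition (c) fixes both wave functions. Its two forms bound its
shifts from opposite sides, so it is finite and expresses the difference at $s$ by those at
$s-[1]_a+k\boldsymbol 1$, $k\in\{0,1\}$ (`WaveData.IsWave.exists_shift`). Vanishing therefore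
spreads from each line $x+\mathbb Z\boldsymbol 1$ to $x+[1]_a+\mathbb Z\boldsymbol 1$, and these
steps reach all of $\mathbb Z^N$. -/

theorem coeff_pow_eq_zero_of_degree_lt {f : ZFn σ} (hf : constantCoeff f = 0) {d : ℕ} {m : σ →₀ ℕ}
    (h : m.degree < d) : coeff m (f ^ d) = 0 := by
  apply coeff_of_lt_order
  have h1 : (1 : ℕ∞) ≤ f.order := one_le_order_iff_constCoeff_eq_zero.mpr hf
  calc (m.degree : ℕ∞) < d := by exact_mod_cast h
    _ = d • (1 : ℕ∞) := by simp
    _ ≤ d • f.order := by gcongr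
    _ ≤ _ := le_order_pow d

/-- The Taylor polynomial of the exponential. -/
def expTrunc (K : ℕ) (f : ZFn σ) : ZFn σ :=
  ∑ d ∈ Finset.range K, 
    C (algebraMap ℂ (LaurentSeries ℂ) (PowerSeries.coeff d (PowerSeries.exp ℂ))) * f ^ d

theorem coeff_expZ {f : ZFn σ} (hf : constantCoeff f = 0) {K : ℕ} {m : σ →₀ ℕ}
    (h : m.degree < K) : coeff m (expZ f) = coeff m (expTrunc K f) := by
  rw [expZ, PowerSeries.coeff_subst (PowerSeries.HasSubst.of_constantCoeff_zero hf), expTrunc,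
    finsum_eq_sum_of_support_subset (s := Finset.range K), map_sum]
  · exact Finset.sum_congr rfl fun d _ => by rw [coeff_C_mul, Algebra.smul_def]
  · intro d hd
    by_contra hc
    apply hd
    simp only [Finset.coe_range, Set.mem_Iio, not_lt] at hc
    simp only
    rw [coeff_pow_eq_zero_of_degree_lt hf (h.trans_le hc), Algebra.smul_def, mul_zero]

/-- The coefficients $e_d$ of the exponential satisfy $(d+1)e_{d+1}=e_d$; differentiation costs one
order of the truncation. -/
theorem pderiv_expTrunc (i : σ) (K : ℕ) (f : ZFn σ) :
    pderiv (LaurentSeries ℂ) i (expTrunc (K + 1) f) =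
      pderiv (LaurentSeries ℂ) i f * expTrunc K f := by
  rw [expTrunc, Finset.sum_range_succ', expTrunc]
  simp only [map_add, map_sum, Derivation.leibniz, pderiv_C, pderiv_pow, smul_eq_mul]
  simp only [Nat.cast_zero, zero_mul, mul_zero, add_zero, Nat.add_sub_cancel, Finset.mul_sum]
  refine Finset.sum_congr rfl fun d _ => ?_
  have h : (PowerSeries.coeff d (PowerSeries.exp ℂ)) =
      PowerSeries.coeff (d + 1) (PowerSeries.exp ℂ) * ((d + 1 : ℕ) : ℂ) := by
    conv_lhs => rw [← PowerSeries.derivative_exp ℂ, PowerSeries.coeff_derivative]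
    push_cast; rfl
  rw [h, map_mul, map_mul, map_natCast, map_natCast]
  ring

theorem pderiv_expZ {f : ZFn σ} (hf : constantCoeff f = 0) (i : σ) :
    pderiv (LaurentSeries ℂ) i (expZ f) = pderiv (LaurentSeries ℂ) i f * expZ f := by
  classical
  ext1 m
  -- The derivative reads a coefficient of degree one higher, and its formula for truncations loses
  -- one more order; hence `m.degree + 1 + 1`.
  have h1 : coeff m (pderiv (LaurentSeries ℂ) i (expZ f)) =
      coeff m (pderiv (LaurentSeries ℂ) i (expTrunc (m.degree + 1 + 1) f)) := by
    rw [coeff_pderiv, coeff_pderiv, coeff_expZ hf (K := m.degree + 1 + 1) (by simp)]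
  rw [h1, pderiv_expTrunc, coeff_mul, coeff_mul]
  refine Finset.sum_congr rfl fun p hp => ?_
  rw [coeff_expZ hf (K := m.degree + 1)]
  rw [← Finset.HasAntidiagonal.mem_antidiagonal.mp hp, map_add]
  omega

theorem constantCoeff_expZ {f : ZFn σ} (hf : constantCoeff f = 0) :
    constantCoeff (expZ f) = 1 := by
  rw [← coeff_zero_eq_constantCoeff_apply, coeff_expZ hf (K := 1) (by simp), expTrunc]
  simp

theorem eq_one_of_pderiv_eq_zero {f : ZFn σ} (hD : ∀ i, pderiv (LaurentSeries ℂ) i f = 0)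
    (hf : constantCoeff f = 1) : f = 1 :=
  have : IsAddTorsionFree (LaurentSeries ℂ) := IsAddTorsionFree.of_isTorsionFree ℂ _
  pderiv.ext (fun i => by rw [hD, pderiv_one]) (by simp [hf])

theorem expZ_mul_expZ_neg {f : ZFn σ} (hf : constantCoeff f = 0) : expZ f * expZ (-f) = 1 := by
  have hf' : constantCoeff (-f) = 0 := by simp [hf]
  refine eq_one_of_pderiv_eq_zero (fun i => ?_) ?_
  · rw [Derivation.leibniz, pderiv_expZ hf, pderiv_expZ hf', map_neg]
    simp only [smul_eq_mul]
    ring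
  · rw [map_mul, constantCoeff_expZ hf, constantCoeff_expZ hf', one_mul]

/-- Uniqueness for a linear differential equation: all derivatives of $ge^{-f}$ vanish. This gives
additivity of the exponential and its compatibility with renaming without manipulating the
substitution. -/
theorem eq_expZ_of_pderiv {f g : ZFn σ} (hf : constantCoeff f = 0) (hg : constantCoeff g = 1)
    (hD : ∀ i, pderiv (LaurentSeries ℂ) i g = pderiv (LaurentSeries ℂ) i f * g) :
    g = expZ f := by
  have hf' : constantCoeff (-f) = 0 := by simp [hf]
  have h : g * expZ (-f) = 1 := by
    refine eq_one_of_pderiv_eq_zero (fun i => ?_) ?_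
    · rw [Derivation.leibniz, hD, pderiv_expZ hf', map_neg]
      simp only [smul_eq_mul]
      ring
    · rw [map_mul, hg, constantCoeff_expZ hf', one_mul]
  calc g = g * (expZ f * expZ (-f)) := by rw [expZ_mul_expZ_neg hf, mul_one]
    _ = (g * expZ (-f)) * expZ f := by ring
    _ = _ := by rw [h, one_mul]

end Exponential

/-! ### Coefficients with respect to the spectral parameter -/

section Coefficients

variable {σ : Type}

/-- The coefficient of `z^{-n}`. -/
def zcoeff (n : ℤ) : ZFn σ →+ MvPowerSeries σ ℂ where
  toFun F m := (coeff m F).coeff n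
  map_zero' := rfl
  map_add' _ _ := rfl

theorem coeff_zcoeff (n : ℤ) (F : ZFn σ) (m : σ →₀ ℕ) :
    coeff m (zcoeff n F) = (coeff m F).coeff n := rfl

theorem oint_eq (F : ZFn σ) : oint F = C (2 * Real.pi * Complex.I) * zcoeff 1 F := by
  ext m
  rw [coeff_C_mul]
  rfl

theorem ext_zcoeff {F G : ZFn σ} (h : ∀ n, zcoeff n F = zcoeff n G) : F = G := by
  ext m n
  rw [← coeff_zcoeff, h, coeff_zcoeff]

theorem zcoeff_ofFn_mul (n : ℤ) (a : MvPowerSeries σ ℂ) (F : ZFn σ) :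
    zcoeff n (ofFn a * F) = a * zcoeff n F := by
  classical
  ext m
  rw [coeff_zcoeff, coeff_mul, coeff_mul, HahnSeries.coeff_sum]
  refine Finset.sum_congr rfl fun p _ => ?_
  rw [ofFn, coeff_map, HahnSeries.C_mul_eq_smul, HahnSeries.coeff_smul, coeff_zcoeff, smul_eq_mul]

/-- The Laurent variable is $z^{-1}$, so multiplication by $z^k$ raises the index that is read by
$k$. -/
theorem zcoeff_zpow_mul (n k : ℤ) (F : ZFn σ) :
    zcoeff n (zpow k * F) = zcoeff (n + k) F := by
  ext m
  rw [coeff_zcoeff, coeff_zcoeff, zpow, coeff_C_mul]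
  have h : n = (n + k) + -k := by ring
  conv_lhs => rw [h, HahnSeries.coeff_single_mul_add, one_mul]

theorem zpow_add (k l : ℤ) : (zpow (k + l) : ZFn σ) = zpow k * zpow l := by
  rw [zpow, zpow, zpow, ← map_mul, HahnSeries.single_mul_single, one_mul, neg_add]

theorem zpow_zero : (zpow 0 : ZFn σ) = 1 := by
  simp [zpow]

/-- A sequence extended by zero to negative indices. -/
def extend {M : Type*} [Zero M] (c : ℕ → M) (n : ℤ) : M := if 0 ≤ n then c n.toNat else 0

theorem extend_natCast {M : Type*} [Zero M] (c : ℕ → M) (n : ℕ) : extend c n = c n := by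
  simp [extend]

theorem extend_of_neg {M : Type*} [Zero M] (c : ℕ → M) {n : ℤ} (h : n < 0) : extend c n = 0 :=
  if_neg (not_le.mpr h)

theorem coeff_ofPowerSeries (f : PowerSeries ℂ) (n : ℤ) :
    (HahnSeries.ofPowerSeries ℤ ℂ f).coeff n = extend (fun j => PowerSeries.coeff j f) n := by
  obtain ⟨j, rfl⟩ | h := (le_or_gt 0 n).imp_left Int.eq_ofNat_of_zero_le
  · rw [extend_natCast]
    exact HahnSeries.ofPowerSeries_apply_coeff f j
  · rw [extend_of_neg _ h, HahnSeries.ofPowerSeries_apply]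
    apply HahnSeries.embDomain_of_notMem_range
    rintro ⟨j, hj⟩
    simp at hj
    omega

theorem zcoeff_zSeries (n : ℤ) (c : ℕ → MvPowerSeries σ ℂ) :
    zcoeff n (zSeries c) = extend c n := by
  ext m
  rw [coeff_zcoeff]
  refine (coeff_ofPowerSeries _ n).trans ?_
  simp only [PowerSeries.coeff_mk, extend]
  split_ifs <;> simp

theorem zcoeff_zSeries_mul_zSeries (n : ℤ) (a b : ℕ → MvPowerSeries σ ℂ) :
    zcoeff n (zSeries a * zSeries b) =
      extend (fun k => ∑ p ∈ Finset.HasAntidiagonal.antidiagonal k, a p.1 * b p.2) n := by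
  classical
  ext m
  rw [coeff_zcoeff, coeff_mul]
  have h : ∀ (c : ℕ → MvPowerSeries σ ℂ) (q : σ →₀ ℕ), coeff q (zSeries c) =
    HahnSeries.ofPowerSeries ℤ ℂ (PowerSeries.mk fun j => coeff q (c j)) := fun _ _ => rfl
  simp only [h, ← map_mul, ← map_sum, coeff_ofPowerSeries, extend]
  split_ifs
  · simp only [map_sum, PowerSeries.coeff_mul, PowerSeries.coeff_mk, coeff_mul]
    exact Finset.sum_comm
  · simp

theorem zcoeff_pderiv (n : ℤ) (i : σ) (F : ZFn σ) :
    zcoeff n (pderiv (LaurentSeries ℂ) i F) = pderiv ℂ i (zcoeff n F) := by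
  ext m
  rw [coeff_zcoeff, coeff_pderiv, coeff_pderiv, coeff_zcoeff]
  have h : ((m i : LaurentSeries ℂ) + 1) = HahnSeries.C ((m i : ℂ) + 1) := by
    rw [map_add, map_natCast, map_one]
  rw [h, mul_comm, HahnSeries.C_mul_eq_smul, HahnSeries.coeff_smul, smul_eq_mul, mul_comm]

theorem zcoeff_rename {ρ : Type} (f : σ → ρ) [Filter.TendstoCofinite f] (n : ℤ) (F : ZFn σ) :
    zcoeff n (rename f F) = rename f (zcoeff n F) := by
  ext m
  rw [coeff_zcoeff, coeff_rename, coeff_rename, HahnSeries.coeff_sum]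
  rfl

theorem rename_ofFn {ρ : Type} (f : σ → ρ) [Filter.TendstoCofinite f] (a : MvPowerSeries σ ℂ) :
    rename f (ofFn a) = ofFn (rename f a) := rename_map f _ a

theorem rename_zpow {ρ : Type} (f : σ → ρ) [Filter.TendstoCofinite f] (k : ℤ) :
    rename f (zpow k) = zpow k := rename_C f _

theorem pderiv_zpow (i : σ) (k : ℤ) : pderiv (LaurentSeries ℂ) i (zpow k) = 0 := pderiv_C

theorem pderiv_zSeries (i : σ) (c : ℕ → MvPowerSeries σ ℂ) :
    pderiv (LaurentSeries ℂ) i (zSeries c) = zSeries fun j => pderiv ℂ i (c j) := by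
  apply ext_zcoeff
  intro n
  rw [zcoeff_pderiv, zcoeff_zSeries, zcoeff_zSeries, extend, extend]
  split_ifs <;> simp

end Coefficients

/-! ### Renaming of variables and restriction to the diagonal -/

section Rename

variable {R : Type*} [CommRing R] {σ ρ : Type}

theorem pderiv_rename_embedding (e : σ ↪ ρ) (i : σ) (f : MvPowerSeries σ R) :
    pderiv R (e i) (rename e f) = rename e (pderiv R i f) := by
  classical
  ext m
  rw [coeff_pderiv]
  by_cases hm : m ∈ Set.range (Finsupp.mapDomain e)
  · obtain ⟨m, rfl⟩ := hm
    rw [← Finsupp.embDomain_eq_mapDomain, coeff_embDomain_rename, coeff_pderiv,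
      ← Finsupp.embDomain_single, ← Finsupp.embDomain_add, coeff_embDomain_rename,
      Finsupp.embDomain_apply_self]
  · rw [coeff_rename_eq_zero e _ hm, coeff_rename_eq_zero e, zero_mul]
    rintro ⟨m', hm'⟩
    apply hm
    refine ⟨m' - Finsupp.single i 1, ?_⟩
    have hi : 1 ≤ m' i := by
      have := DFunLike.congr_fun hm' (e i)
      rw [Finsupp.mapDomain_apply e.injective] at this
      simp at this
      omega
    have h2 : m' - Finsupp.single i 1 + Finsupp.single i 1 = m' :=
      tsub_add_cancel_of_le (Finsupp.single_le_iff.mpr hi)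
    rw [← h2, Finsupp.mapDomain_add, Finsupp.mapDomain_single] at hm'
    exact add_right_cancel hm'

theorem pderiv_rename_of_notMem {e : σ ↪ ρ} {j : ρ} (hj : j ∉ Set.range e)
    (f : MvPowerSeries σ R) : pderiv R j (rename e f) = 0 := by
  classical
  ext m
  rw [coeff_pderiv, coeff_rename_eq_zero e, zero_mul, coeff_zero]
  rintro ⟨m', hm'⟩
  have := DFunLike.congr_fun hm' j
  rw [Finsupp.mapDomain_of_notMem_range _ _ hj] at this
  simp at this

/-- Every fibre of the codiagonal has two points. This makes identification of the two sets of
variables legitimate for series in infinitely many variables. -/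
instance tendstoCofinite_sumElim_id : Filter.TendstoCofinite (Sum.elim id id : σ ⊕ σ → σ) := by
  rw [Filter.tendstoCofinite_iff_finite_preimage_singleton]
  intro b
  refine (Set.toFinite {Sum.inl b, Sum.inr b}).subset ?_
  rintro (a | a) h <;> simp at h <;> simp [h]

/-- Restriction to the diagonal, where the two sets of variables are equal. -/
def diagonal : MvPowerSeries (σ ⊕ σ) R →ₐ[R] MvPowerSeries σ R := rename (Sum.elim id id)

theorem diagonal_rename_inl (f : MvPowerSeries σ R) :
    diagonal (rename (Function.Embedding.inl : σ ↪ σ ⊕ σ) f) = f :=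
  (rename_rename _ _ f).trans (rename_id_apply f)

theorem diagonal_rename_inr (f : MvPowerSeries σ R) :
    diagonal (rename (Function.Embedding.inr : σ ↪ σ ⊕ σ) f) = f :=
  (rename_rename _ _ f).trans (rename_id_apply f)

end Rename

/-! ### The series `xi` and its derivatives -/

section Xi

variable {σ : Type}

theorem constantCoeff_xi (e : ℕ+ → σ) : constantCoeff (xi fun k => X (e k)) = 0 := by
  have : ∀ k, coeff 0 (X (e k) : MvPowerSeries σ ℂ) = 0 := by simp
  change (∑ᶠ k : ℕ+, HahnSeries.single (-(k : ℤ)) (coeff 0 (X (e k)))) = 0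
  simp [this]

theorem xi_sub (e e' : ℕ+ ↪ σ) : xi (fun k => X (e k) - X (e' k)) =
    xi (fun k => X (e k)) - xi (fun k => X (e' k)) := by
  classical
  -- A given monomial equals at most one of the variables `e k`, so these are finite sums and may be
  -- subtracted termwise.
  have hfin : ∀ (e : ℕ+ ↪ σ) (m : σ →₀ ℕ), (Function.support fun k : ℕ+ =>
      (HahnSeries.single (-(k : ℤ)) (coeff m (X (e k))) : LaurentSeries ℂ)).Finite := by
    intro e m
    refine Set.Subsingleton.finite ?_
    have key : ∀ k, k ∈ (Function.support fun k : ℕ+ =>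
      (HahnSeries.single (-(k : ℤ)) (coeff m (X (e k))) : LaurentSeries ℂ)) →
        m = Finsupp.single (e k) 1 := by
      intro k hk
      by_contra hc
      apply hk
      simp [coeff_X, hc]
    intro a ha b hb
    have h := (key a ha).symm.trans (key b hb)
    exact e.injective (Finsupp.single_left_injective one_ne_zero h)
  ext1 m
  refine Eq.trans ?_ (finsum_sub_distrib (hfin e m) (hfin e' m))
  refine finsum_congr fun k => ?_
  simp

theorem pderiv_xi (e : ℕ+ ↪ σ) (k : ℕ+) :
    pderiv (LaurentSeries ℂ) (e k) (xi fun k => X (e k)) = zpow k := by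
  classical
  ext1 m
  rw [coeff_pderiv, zpow, coeff_C]
  change (∑ᶠ l : ℕ+, HahnSeries.single (-(l : ℤ))
    (coeff (m + Finsupp.single (e k) 1) (X (e l)))) * _ = _
  rw [finsum_eq_single _ k]
  · rw [coeff_X]
    by_cases hm : m = 0 <;> simp [hm]
  · intro l hl
    rw [coeff_X, if_neg, map_zero]
    intro h
    have := DFunLike.congr_fun h (e k)
    simp [hl] at this

theorem pderiv_xi_of_notMem {e : ℕ+ → σ} {i : σ} (hi : i ∉ Set.range e) :
    pderiv (LaurentSeries ℂ) i (xi fun k => X (e k)) = 0 := by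
  classical
  ext1 m
  rw [coeff_pderiv]
  change (∑ᶠ l : ℕ+, HahnSeries.single (-(l : ℤ))
    (coeff (m + Finsupp.single i 1) (X (e l)))) * _ = _
  rw [finsum_eq_zero_of_forall_eq_zero, zero_mul, coeff_zero]
  intro l
  rw [coeff_X, if_neg, map_zero]
  intro h
  have h2 : e l ≠ i := fun h => hi ⟨l, h⟩
  have := DFunLike.congr_fun h i
  simp [h2] at this

end Xi

/-! ### Separation of the two sets of times in the exponential factor -/

section ExpXiDiff

variable {N : ℕ}

/-- The series `ξ` of one family of times. -/
def xiVar (φ : Fin N ⊕ Fin N) : ZFn (Times N) := xi fun k => X (φ, k)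

theorem constantCoeff_xiVar (φ : Fin N ⊕ Fin N) : constantCoeff (xiVar φ) = 0 :=
  constantCoeff_xi _

theorem pderiv_xiVar (φ : Fin N ⊕ Fin N) (i : Times N) :
    pderiv (LaurentSeries ℂ) i (xiVar φ) = if i.1 = φ then zpow i.2 else 0 := by
  split_ifs with h
  · obtain ⟨ψ, k⟩ := i
    subst h
    exact pderiv_xi ⟨fun k => (ψ, k), Prod.mk_right_injective ψ⟩ k
  · apply pderiv_xi_of_notMem
    rintro ⟨k, rfl⟩
    exact h rfl

theorem inFst_eq (f : ZFn (Times N)) : inFst f = rename (Function.Embedding.inl) f := rfl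

theorem inSnd_eq (f : ZFn (Times N)) : inSnd f = rename (Function.Embedding.inr) f := rfl

theorem pderiv_inl_inFst (i : Times N) (f : ZFn (Times N)) :
    pderiv (LaurentSeries ℂ) (Sum.inl i) (inFst f) = inFst (pderiv (LaurentSeries ℂ) i f) :=
  pderiv_rename_embedding Function.Embedding.inl i f

theorem pderiv_inl_inSnd (i : Times N) (f : ZFn (Times N)) :
    pderiv (LaurentSeries ℂ) (Sum.inl i) (inSnd f) = 0 :=
  pderiv_rename_of_notMem (by simp) f

/-- In characteristic zero a series is determined by its derivatives and constant term, and the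
derivatives of `xi` are just powers of $z$ or zero. -/
theorem rename_xi {ρ σ : Type} (e : σ ↪ ρ) (x : ℕ+ ↪ σ) :
    rename e (xi fun k => X (x k)) = xi fun k => X (e (x k)) := by
  have : IsAddTorsionFree (LaurentSeries ℂ) := IsAddTorsionFree.of_isTorsionFree ℂ _
  refine pderiv.ext (fun j => ?_) ?_
  · by_cases hj : j ∈ Set.range (x.trans e)
    · obtain ⟨k, rfl⟩ := hj
      exact (pderiv_rename_embedding e (x k) _).trans <|
        (congrArg _ (pderiv_xi x k)).trans <| (rename_zpow e k).trans (pderiv_xi (x.trans e) k).symm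
    · refine Eq.trans ?_ (pderiv_xi_of_notMem (e := x.trans e) hj).symm
      by_cases hj' : j ∈ Set.range e
      · obtain ⟨i, rfl⟩ := hj'
        rw [pderiv_rename_embedding, pderiv_xi_of_notMem, map_zero]
        rintro ⟨k, rfl⟩
        exact hj ⟨k, rfl⟩
      · exact pderiv_rename_of_notMem hj' _
  · rw [constantCoeff_rename, constantCoeff_xi, constantCoeff_xi]

theorem rename_expZ {ρ σ : Type} (e : σ ↪ ρ) {f : ZFn σ} (hf : constantCoeff f = 0) :
    rename e (expZ f) = expZ (rename e f) := by
  apply eq_expZ_of_pderiv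
  · rw [constantCoeff_rename, hf]
  · rw [constantCoeff_rename, constantCoeff_expZ hf]
  · intro j
    by_cases hj : j ∈ Set.range e
    · obtain ⟨i, rfl⟩ := hj
      rw [pderiv_rename_embedding, pderiv_rename_embedding, pderiv_expZ hf, map_mul]
    · rw [pderiv_rename_of_notMem hj, pderiv_rename_of_notMem hj, zero_mul]

theorem expZ_add {σ : Type} {f g : ZFn σ} (hf : constantCoeff f = 0) (hg : constantCoeff g = 0) :
    expZ (f + g) = expZ f * expZ g := by
  refine (eq_expZ_of_pderiv ?_ ?_ fun i => ?_).symm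
  · simp [hf, hg]
  · simp [constantCoeff_expZ, hf, hg]
  · rw [Derivation.leibniz, pderiv_expZ hf, pderiv_expZ hg, map_add]
    simp only [smul_eq_mul]
    ring

/-- The times of one family. -/
def family (φ : Fin N ⊕ Fin N) : ℕ+ ↪ Times N := ⟨fun k => (φ, k), Prod.mk_right_injective φ⟩

theorem inFst_xiVar (φ : Fin N ⊕ Fin N) :
    inFst (xiVar φ) = xi fun k => X (Sum.inl (family φ k)) :=
  rename_xi (Function.Embedding.inl : Times N ↪ Times N ⊕ Times N) (family φ)

theorem inSnd_xiVar (φ : Fin N ⊕ Fin N) :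
    inSnd (xiVar φ) = xi fun k => X (Sum.inr (family φ k)) :=
  rename_xi (Function.Embedding.inr : Times N ↪ Times N ⊕ Times N) (family φ)

theorem xi_inl_sub_inr (φ : Fin N ⊕ Fin N) :
    xi (fun k => X (Sum.inl (φ, k)) - X (Sum.inr (φ, k))) = inFst (xiVar φ) + inSnd (-xiVar φ) := by
  have h : inSnd (-xiVar φ) = -inSnd (xiVar φ) := map_neg _ _
  rw [h, ← sub_eq_add_neg, inFst_xiVar, inSnd_xiVar]
  exact xi_sub ((family φ).trans (Function.Embedding.inl : Times N ↪ Times N ⊕ Times N))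
    ((family φ).trans (Function.Embedding.inr : Times N ↪ Times N ⊕ Times N))

theorem expXiDiff_eq (φ : Fin N ⊕ Fin N) :
    expXiDiff φ = inFst (expZ (xiVar φ)) * inSnd (expZ (-xiVar φ)) := by
  have h0 := constantCoeff_xiVar φ
  have h0' : constantCoeff (-xiVar φ) = 0 := by simp [h0]
  rw [expXiDiff, xi_inl_sub_inr, inFst_eq, inSnd_eq, inFst_eq, inSnd_eq, rename_expZ _ h0, rename_expZ _ h0',
    expZ_add]
  · rw [constantCoeff_rename, h0]
  · rw [constantCoeff_rename, h0']

end ExpXiDiff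

/-! ### Algebra of difference operators that extend in one direction -/

theorem exists_ne_zero_of_finsum_ne_zero {ι M : Type*} [AddCommMonoid M] {f : ι → M}
    (h : ∑ᶠ i, f i ≠ 0) : ∃ i, f i ≠ 0 := by
  by_contra! hf
  exact h (finsum_eq_zero_of_forall_eq_zero hf)

namespace DiffOp

variable {N : ℕ}

theorem diagVec_add (j k : ℤ) : diagVec N (j + k) = diagVec N j + diagVec N k := rfl

theorem diagVec_zero : diagVec N 0 = 0 := rfl

theorem diagVec_injective [Nonempty (Fin N)] : Function.Injective (diagVec N) :=
  fun _ _ h => congrFun h (Classical.arbitrary _)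

@[ext]
theorem ext {A B : DiffOp N} (h : ∀ v s, A v s = B v s) : A = B :=
  funext fun v => funext fun s => h v s

theorem mul_apply (A B : DiffOp N) (v s : Lat N) :
    (A * B) v s = ∑ᶠ u : Lat N, A u s * B (v - u) (s + u) := rfl

theorem add_apply (A B : DiffOp N) (v s : Lat N) : (A + B) v s = A v s + B v s := rfl

theorem sub_apply (A B : DiffOp N) (v s : Lat N) : (A - B) v s = A v s - B v s := rfl

theorem zero_apply (v s : Lat N) : (0 : DiffOp N) v s = 0 := rfl

theorem one_def : (1 : DiffOp N) = ofMat 1 := rfl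

/-- The shifts of `A` are `a + ε j 𝟏` with `j ≤ k`. For `ε = 1` and `ε = -1` these are operators
which extend in the direction of negative and of positive shifts, respectively. -/
def ShiftsLE (ε : ℤ) (a : Lat N) (k : ℤ) (A : DiffOp N) : Prop :=
  ∀ v s, A v s ≠ 0 → ∃ j ≤ k, v = a + diagVec N (ε * j)

namespace ShiftsLE

variable {ε : ℤ} {a b c : Lat N} {k l r : ℤ} {A B C : DiffOp N}

theorem mono (hA : ShiftsLE ε a k A) (h : k ≤ l) : ShiftsLE ε a l A := fun v s hv =>
  let ⟨j, hj, hv⟩ := hA v s hv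
  ⟨j, hj.trans h, hv⟩

theorem mul (hA : ShiftsLE ε a k A) (hB : ShiftsLE ε b l B) :
    ShiftsLE ε (a + b) (k + l) (A * B) := by
  intro v s hv
  rw [mul_apply] at hv
  obtain ⟨u, hu⟩ := exists_ne_zero_of_finsum_ne_zero hv
  obtain ⟨i, hi, h1⟩ := hA u s (left_ne_zero_of_mul hu)
  obtain ⟨j, hj, h2⟩ := hB _ _ (right_ne_zero_of_mul hu)
  refine ⟨i + j, add_le_add hi hj, ?_⟩
  rw [mul_add, diagVec_add, ← sub_add_cancel v u, h2, h1]
  abel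

theorem zero : ShiftsLE ε a k (0 : DiffOp N) := fun _ _ h => (h rfl).elim

theorem add (hA : ShiftsLE ε a k A) (hB : ShiftsLE ε a k B) : ShiftsLE ε a k (A + B) := by
  intro v s h
  by_cases hA' : A v s = 0
  · refine hB v s fun hB' => h ?_
    rw [add_apply, hA', hB', add_zero]
  · exact hA v s hA'

theorem sum {ι : Type*} {s : Finset ι} {A : ι → DiffOp N} (hA : ∀ i, ShiftsLE ε a k (A i)) :
    ShiftsLE ε a k (∑ i ∈ s, A i) := by
  classical
  induction s using Finset.induction_on with
  | empty => exact zero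
  | insert i s hi ih =>
    rw [Finset.sum_insert hi]
    exact (hA i).add ih

theorem shiftOp (u : Lat N) : ShiftsLE ε u 0 (shiftOp u) := by
  intro v s h
  refine ⟨0, le_rfl, ?_⟩
  rw [mul_zero, diagVec_zero, add_zero]
  by_contra hc
  exact h (if_neg hc)

theorem ofMat (M : Mat N) : ShiftsLE ε 0 0 (ofMat M) := by
  intro v s h
  refine ⟨0, le_rfl, ?_⟩
  rw [mul_zero, diagVec_zero, add_zero]
  by_contra hc
  exact h (if_neg hc)

theorem one : ShiftsLE ε 0 0 (1 : DiffOp N) := ofMat 1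

theorem shiftOp_diagVec (hε : ε * ε = 1) (i : ℤ) :
    ShiftsLE ε 0 (ε * i) (DiffOp.shiftOp (diagVec N i)) := by
  intro v s h
  refine ⟨ε * i, le_rfl, ?_⟩
  rw [← mul_assoc, hε, one_mul, zero_add]
  by_contra hc
  exact h (if_neg hc)

theorem lower (k : ℤ) (c : ℕ → Lat N → Mat N) : ShiftsLE 1 0 k (lower k c) := by
  intro v s h
  obtain ⟨j, hj⟩ := exists_ne_zero_of_finsum_ne_zero h
  refine ⟨k - j, by omega, ?_⟩
  rw [one_mul, zero_add]
  by_contra hc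
  exact hj (if_neg hc)

theorem upper (k : ℤ) (c : ℕ → Lat N → Mat N) : ShiftsLE (-1) 0 (-k) (upper k c) := by
  intro v s h
  obtain ⟨j, hj⟩ := exists_ne_zero_of_finsum_ne_zero h
  refine ⟨-k - j, by omega, ?_⟩
  rw [zero_add, show -1 * (-k - (j : ℤ)) = k + j by ring]
  by_contra hc
  exact hj (if_neg hc)

theorem npow (hA : ShiftsLE ε 0 1 A) (n : ℕ) : ShiftsLE ε 0 n (npow A n) := by
  induction n with
  | zero => exact one
  | succ n ih => simpa using! ih.mul hA

/-- If the two factors shift by $a+\varepsilon i\boldsymbol 1$ and $b+\varepsilon j\boldsymbol 1$,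
then $v$ fixes $i+j$, and the upper bounds on $i$ and $j$ become lower bounds on each other.
Composition is a `finsum`, so the distributive and associative laws rest on this finiteness and hold
for operators extending in the same direction. -/
theorem finite_support [Nonempty (Fin N)] (hε : ε * ε = 1) (hA : ShiftsLE ε a k A)
    (hB : ShiftsLE ε b l B) (v s : Lat N) :
    (Function.support fun u => A u s * B (v - u) (s + u)).Finite := by
  have i0 : Fin N := Classical.arbitrary _
  refine (((Set.finite_Icc (ε * (v i0 - a i0 - b i0) - l) k).image
    fun j => a + diagVec N (ε * j))).subset ?_
  intro u hu
  obtain ⟨i, hi, h1⟩ := hA u s (left_ne_zero_of_mul hu)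
  obtain ⟨j, hj, h2⟩ := hB _ _ (right_ne_zero_of_mul hu)
  refine ⟨i, ⟨?_, hi⟩, h1.symm⟩
  have h3 : v i0 - (a i0 + ε * i) = b i0 + ε * j := by
    rw [h1] at h2
    exact congrFun h2 i0
  have h4 : v i0 - a i0 - b i0 = ε * (i + j) := by linarith
  rw [h4, ← mul_assoc, hε]
  linarith

theorem add_mul [Nonempty (Fin N)] (hε : ε * ε = 1) (hA : ShiftsLE ε a k A)
    (hB : ShiftsLE ε a k B) (hC : ShiftsLE ε c r C) : (A + B) * C = A * C + B * C := by
  ext1 v s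
  rw [add_apply, mul_apply, mul_apply, mul_apply,
    ← finsum_add_distrib (hA.finite_support hε hC v s) (hB.finite_support hε hC v s)]
  simp only [add_apply, _root_.add_mul]

theorem mul_add [Nonempty (Fin N)] (hε : ε * ε = 1) (hA : ShiftsLE ε a k A)
    (hB : ShiftsLE ε b l B) (hC : ShiftsLE ε b l C) : A * (B + C) = A * B + A * C := by
  ext1 v s
  rw [add_apply, mul_apply, mul_apply, mul_apply,
    ← finsum_add_distrib (hA.finite_support hε hB v s) (hA.finite_support hε hC v s)]
  simp only [add_apply, _root_.mul_add]

theorem sum_mul [Nonempty (Fin N)] {ι : Type*} {s : Finset ι} {A : ι → DiffOp N}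
    (hε : ε * ε = 1) (hA : ∀ i, ShiftsLE ε a k (A i)) (hC : ShiftsLE ε c r C) :
    (∑ i ∈ s, A i) * C = ∑ i ∈ s, A i * C := by
  classical
  induction s using Finset.induction_on with
  | empty =>
    ext1 v s
    simp [mul_apply, zero_apply]
  | insert i s hi ih =>
    rw [Finset.sum_insert hi, Finset.sum_insert hi, add_mul hε (hA i) (sum hA) hC, ih]

theorem mul_sum [Nonempty (Fin N)] {ι : Type*} {s : Finset ι} {B : ι → DiffOp N}
    (hε : ε * ε = 1) (hA : ShiftsLE ε a k A) (hB : ∀ i, ShiftsLE ε b l (B i)) :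
    A * (∑ i ∈ s, B i) = ∑ i ∈ s, A * B i := by
  classical
  induction s using Finset.induction_on with
  | empty =>
    ext1 v s
    simp [mul_apply, zero_apply]
  | insert i s hi ih =>
    rw [Finset.sum_insert hi, Finset.sum_insert hi, mul_add hε hA (hB i) (sum hB), ih]

/-- Both sides are one finite double sum, over the shift `x` of `A` and the accumulated shift `u` of
`A` and `B`. -/
theorem mul_assoc [Nonempty (Fin N)] (hε : ε * ε = 1) (hA : ShiftsLE ε a k A)
    (hB : ShiftsLE ε b l B) (hC : ShiftsLE ε c r C) : A * B * C = A * (B * C) := by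
  have i0 : Fin N := Classical.arbitrary _
  ext1 v s
  have hfin : (Function.support fun p : Lat N × Lat N =>
      A p.1 s * B (p.2 - p.1) (s + p.1) * C (v - p.2) (s + p.2)).Finite := by
    -- `M` is the value forced on the sum $i+j+t$ of the three shift indices; with their upper
    -- bounds it confines $i$ and $j$ to intervals.
    set M := ε * (v i0 - a i0 - b i0 - c i0)
    refine (((Set.finite_Icc (M - l - r) k).prod (Set.finite_Icc (M - k - r) l)).image
      fun q => (a + diagVec N (ε * q.1), a + b + diagVec N (ε * (q.1 + q.2)))).subset ?_
    rintro ⟨x, u⟩ hp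
    have hAB := left_ne_zero_of_mul hp
    obtain ⟨i, hi, h1⟩ := hA _ _ (left_ne_zero_of_mul hAB)
    obtain ⟨j, hj, h2⟩ := hB _ _ (right_ne_zero_of_mul hAB)
    obtain ⟨t, ht, h3⟩ := hC _ _ (right_ne_zero_of_mul hp)
    simp only at h1 h2 h3
    have h4 : u = a + b + diagVec N (ε * (i + j)) := by
      rw [← sub_add_cancel u x, h2, h1, _root_.mul_add, diagVec_add]
      abel
    have h5 : M = i + j + t := by
      have h6 : v i0 - (a i0 + b i0 + ε * (i + j)) = c i0 + ε * t := by
        rw [h4] at h3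
        exact congrFun h3 i0
      have h7 : v i0 - a i0 - b i0 - c i0 = ε * (i + j + t) := by linarith
      change ε * (v i0 - a i0 - b i0 - c i0) = _
      rw [h7, ← _root_.mul_assoc, hε, one_mul]
    exact ⟨(i, j), ⟨⟨by simp only; linarith, hi⟩, ⟨by simp only; linarith, hj⟩⟩,
      Prod.ext h1.symm h4.symm⟩
  have h1 : (A * B * C) v s = ∑ᶠ u, ∑ᶠ x,
      A x s * B (u - x) (s + x) * C (v - u) (s + u) := by
    rw [mul_apply]
    refine finsum_congr fun u => ?_
    rw [mul_apply, finsum_mul' _ _ (hA.finite_support hε hB u s)]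
  have h2 : (A * (B * C)) v s = ∑ᶠ x, ∑ᶠ u,
      A x s * B (u - x) (s + x) * C (v - u) (s + u) := by
    rw [mul_apply]
    refine finsum_congr fun x => ?_
    rw [mul_apply, mul_finsum' _ _ (hB.finite_support hε hC (v - x) (s + x))]
    rw [← finsum_comp_equiv (Equiv.subRight x)]
    refine finsum_congr fun u => ?_
    simp only [Equiv.subRight_apply]
    rw [_root_.mul_assoc, sub_sub_sub_cancel_right, add_assoc, add_sub_cancel]
  have hfin' : (Function.support fun p : Lat N × Lat N =>
      A p.2 s * B (p.1 - p.2) (s + p.2) * C (v - p.1) (s + p.1)).Finite := by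
    refine (hfin.image Prod.swap).subset ?_
    rintro ⟨x, u⟩ hp
    exact ⟨(u, x), hp, rfl⟩
  rw [h1, h2, ← finsum_curry _ hfin, ← finsum_curry _ hfin', ← finsum_comp_equiv (Equiv.prodComm _ _)]
  rfl

end ShiftsLE

theorem mul_shiftOp_apply (A : DiffOp N) (u v s : Lat N) : (A * shiftOp u) v s = A (v - u) s := by
  rw [mul_apply, finsum_eq_single _ (v - u)]
  · simp [shiftOp]
  · intro x hx
    rw [shiftOp, if_neg, mul_zero]
    rintro h
    apply hx
    rw [← h, sub_sub_cancel]

theorem mul_ofMat_apply (A : DiffOp N) (M : Mat N) (v s : Lat N) :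
    (A * ofMat M) v s = A v s * M := by
  rw [mul_apply, finsum_eq_single _ v]
  · simp [ofMat]
  · intro x hx
    rw [ofMat, if_neg, mul_zero]
    rintro h
    apply hx
    rw [sub_eq_zero.mp h]

theorem mul_one' (A : DiffOp N) : A * 1 = A := by
  ext1 v s
  rw [one_def, mul_ofMat_apply, mul_one]

theorem one_mul' (A : DiffOp N) : 1 * A = A := by
  ext1 v s
  rw [mul_apply, finsum_eq_single _ 0]
  · simp [one_def, ofMat]
  · intro x hx
    rw [one_def, ofMat, if_neg hx, zero_mul]

theorem mul_apply_of_support {A B : DiffOp N} {v s : Lat N} {ι : Type*} (T : Finset ι)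
    {e : ι → Lat N} (he : Function.Injective e)
    (h : ∀ u, A u s * B (v - u) (s + u) ≠ 0 → ∃ i ∈ T, u = e i) :
    (A * B) v s = ∑ i ∈ T, A (e i) s * B (v - e i) (s + e i) := by
  classical
  rw [mul_apply, finsum_eq_sum_of_support_subset (s := T.image e),
    Finset.sum_image fun _ _ _ _ h => he h]
  intro u hu
  obtain ⟨i, hi, rfl⟩ := h u hu
  exact Finset.mem_coe.mpr (Finset.mem_image_of_mem e hi)

/-- The operator `∑_{j ≥ 0} c_j(s) e^{-ε j ∂_s}`. -/
def series (ε : ℤ) (c : ℕ → Lat N → Mat N) : DiffOp N :=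
  fun v s => ∑ᶠ j : ℕ, if v = diagVec N (-(ε * j)) then c j s else 0

theorem lower_zero_eq (c : ℕ → Lat N → Mat N) : lower 0 c = series 1 c := by
  ext1 v s
  refine finsum_congr fun j => ?_
  rw [zero_sub, one_mul]

theorem upper_zero_eq (c : ℕ → Lat N → Mat N) : upper 0 c = series (-1) c := by
  ext1 v s
  refine finsum_congr fun j => ?_
  rw [zero_add, neg_one_mul, neg_neg]

theorem ShiftsLE.series (ε : ℤ) (c : ℕ → Lat N → Mat N) : ShiftsLE ε 0 0 (series ε c) := by
  intro v s h
  obtain ⟨j, hj⟩ := exists_ne_zero_of_finsum_ne_zero h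
  refine ⟨-j, by omega, ?_⟩
  rw [zero_add, mul_neg]
  by_contra hc
  exact hj (if_neg hc)

theorem series_apply [Nonempty (Fin N)] {ε : ℤ} (hε : ε * ε = 1) (c : ℕ → Lat N → Mat N)
    (n : ℤ) (s : Lat N) : series ε c (diagVec N (-(ε * n))) s = extend (fun j => c j s) n := by
  have hε0 : ε ≠ 0 := left_ne_zero_of_mul (hε.trans_ne one_ne_zero)
  have hiff : ∀ j : ℕ, diagVec N (-(ε * n)) = diagVec N (-(ε * j)) ↔ n = j := fun j => by
    rw [diagVec_injective.eq_iff, neg_inj, mul_right_inj' hε0]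
  simp only [series, hiff]
  obtain ⟨j, rfl⟩ | h := (le_or_gt 0 n).imp_left Int.eq_ofNat_of_zero_le
  · rw [extend_natCast, finsum_eq_single _ j, if_pos rfl]
    intro i hi
    rw [if_neg]
    exact_mod_cast hi.symm
  · rw [extend_of_neg _ h]
    refine finsum_eq_zero_of_forall_eq_zero fun j => ?_
    rw [if_neg]
    omega

theorem series_mul_series_apply [Nonempty (Fin N)] {ε : ℤ} (hε : ε * ε = 1)
    (c d : ℕ → Lat N → Mat N) (n : ℕ) (s : Lat N) :
    (series ε c * series ε d) (diagVec N (-(ε * n))) s =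
      ∑ p ∈ Finset.HasAntidiagonal.antidiagonal n, c p.1 s * d p.2 (s + diagVec N (-(ε * p.1))) := by
  have hε0 : ε ≠ 0 := left_ne_zero_of_mul (hε.trans_ne one_ne_zero)
  have hinj : Function.Injective fun i : ℕ => diagVec N (-(ε * i)) := by
    intro i j h
    have := diagVec_injective h
    rw [neg_inj, mul_right_inj' hε0] at this
    exact_mod_cast this
  rw [mul_apply_of_support (Finset.range (n + 1)) hinj,
    Finset.Nat.sum_antidiagonal_eq_sum_range_succ_mk]
  · refine Finset.sum_congr rfl fun i hi => ?_
    have hi' : i ≤ n := Finset.mem_range_succ_iff.mp hi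
    have h2 : diagVec N (-(ε * n)) - diagVec N (-(ε * i)) = diagVec N (-(ε * ((n - i : ℕ) : ℤ))) := by
      rw [Nat.cast_sub hi']
      ext
      simp only [diagVec, Pi.sub_apply]
      ring
    rw [h2, series_apply hε, series_apply hε, extend_natCast, extend_natCast]
  · intro u hu
    obtain ⟨i, hi, h1⟩ := ShiftsLE.series ε c _ _ (left_ne_zero_of_mul hu)
    obtain ⟨j, hj, h2⟩ := ShiftsLE.series ε d _ _ (right_ne_zero_of_mul hu)
    rw [zero_add] at h1 h2
    have h3 : (n : ℤ) = -i + -j := by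
      have : diagVec N (-(ε * n)) = diagVec N (-(ε * (-i + -j))) := by
        rw [← sub_add_cancel (diagVec N (-(ε * n))) u, h2, h1, ← diagVec_add]
        congr 1
        ring
      have := diagVec_injective this
      rwa [neg_inj, mul_right_inj' hε0] at this
    refine ⟨i.natAbs, ?_, ?_⟩
    · rw [Finset.mem_range]
      omega
    · rw [h1]
      congr 1
      have : ((i.natAbs : ℕ) : ℤ) = -i := by omega
      rw [this]
      ring

/-- If `A` has finitely many shifts, then its action on a series is given by a finite sum. -/
theorem mul_series_apply [Nonempty (Fin N)] {ε : ℤ} (hε : ε * ε = 1) {A : DiffOp N} {a : Lat N}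
    {K : Finset ℤ} (hA : ∀ v s, A v s ≠ 0 → ∃ k ∈ K, v = a + diagVec N k)
    (c : ℕ → Lat N → Mat N) (n : ℤ) (s : Lat N) :
    (A * series ε c) (a + diagVec N (-(ε * n))) s = ∑ k ∈ K,
      A (a + diagVec N k) s * extend (fun j => c j (s + (a + diagVec N k))) (n + ε * k) := by
  rw [mul_apply_of_support (e := fun k => a + diagVec N k) K
    ((add_right_injective a).comp diagVec_injective)
    fun u hu => hA u s (left_ne_zero_of_mul hu)]
  refine Finset.sum_congr rfl fun k _ => ?_
  have h : a + diagVec N (-(ε * n)) - (a + diagVec N k) = diagVec N (-(ε * (n + ε * k))) := by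
    rw [mul_add, ← mul_assoc, hε, one_mul]
    ext
    simp only [diagVec, Pi.sub_apply, Pi.add_apply]
    ring
  rw [h, series_apply hε]

end DiffOp

/-! ### A uniqueness principle for series in two sets of variables -/

section Vanishing

variable {σ : Type}

theorem exists_sumElim_eq (m : σ ⊕ σ →₀ ℕ) : ∃ A n : σ →₀ ℕ, Finsupp.sumElim A n = m := by
  refine ⟨m.comapDomain Sum.inl Sum.inl_injective.injOn,
    m.comapDomain Sum.inr Sum.inr_injective.injOn, ?_⟩
  ext (i | i) <;> simp

theorem sumElim_add (A B n r : σ →₀ ℕ) :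
    Finsupp.sumElim A n + Finsupp.sumElim B r = Finsupp.sumElim (A + B) (n + r) := by
  ext (i | i) <;> simp

theorem sumElim_inj {A B n r : σ →₀ ℕ} (h : Finsupp.sumElim A n = Finsupp.sumElim B r) :
    A = B ∧ n = r :=
  ⟨Finsupp.ext fun i => by simpa using DFunLike.congr_fun h (Sum.inl i),
    Finsupp.ext fun i => by simpa using DFunLike.congr_fun h (Sum.inr i)⟩

theorem mapDomain_inl (A : σ →₀ ℕ) :
    Finsupp.mapDomain (Function.Embedding.inl : σ ↪ σ ⊕ σ) A = Finsupp.sumElim A 0 := by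
  ext (i | i)
  · exact (Finsupp.mapDomain_apply Sum.inl_injective A i).trans (by simp)
  · exact (Finsupp.mapDomain_of_notMem_range _ _ (by simp)).trans (by simp)

theorem mapDomain_inr (A : σ →₀ ℕ) :
    Finsupp.mapDomain (Function.Embedding.inr : σ ↪ σ ⊕ σ) A = Finsupp.sumElim 0 A := by
  ext (i | i)
  · exact (Finsupp.mapDomain_of_notMem_range _ _ (by simp)).trans (by simp)
  · exact (Finsupp.mapDomain_apply Sum.inr_injective A i).trans (by simp)

theorem mapDomain_sumElim (A n : σ →₀ ℕ) :
    Finsupp.mapDomain (Sum.elim id id) (Finsupp.sumElim A n) = A + n := by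
  have h : Finsupp.sumElim A n = Finsupp.mapDomain (Function.Embedding.inl : σ ↪ σ ⊕ σ) A +
      Finsupp.mapDomain (Function.Embedding.inr : σ ↪ σ ⊕ σ) n := by
    rw [mapDomain_inl, mapDomain_inr, sumElim_add, add_zero, zero_add]
  rw [h, Finsupp.mapDomain_add, ← Finsupp.mapDomain_comp, ← Finsupp.mapDomain_comp]
  exact congrArg₂ _ Finsupp.mapDomain_id Finsupp.mapDomain_id

/-- A factor in the first variables leaves the second exponent unchanged and can only lower the
first exponent that is read from `F`. -/
theorem coeff_rename_inl_mul_eq_zero {R : Type*} [CommRing R] {F : MvPowerSeries (σ ⊕ σ) R}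
    {A n : σ →₀ ℕ} (h : ∀ A' ≤ A, coeff (Finsupp.sumElim A' n) F = 0) (b : MvPowerSeries σ R) :
    coeff (Finsupp.sumElim A n) (rename (Function.Embedding.inl : σ ↪ σ ⊕ σ) b * F) = 0 := by
  classical
  rw [coeff_mul]
  refine Finset.sum_eq_zero fun p hp => ?_
  have hp := Finset.HasAntidiagonal.mem_antidiagonal.mp hp
  by_cases hr : p.1 ∈ Set.range (Finsupp.mapDomain (Function.Embedding.inl : σ ↪ σ ⊕ σ))
  · obtain ⟨P, hP⟩ := hr
    obtain ⟨A', n', hq⟩ := exists_sumElim_eq p.2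
    rw [← hP, ← hq, mapDomain_inl, sumElim_add, zero_add] at hp
    obtain ⟨h1, rfl⟩ := sumElim_inj hp
    rw [← hq, h A' (h1 ▸ le_add_self), mul_zero]
  · rw [coeff_rename_eq_zero _ _ hr, zero_mul]

/-- On the diagonal the coefficient at `n` is the sum over all splittings $A+n'=n$. Those with
$A\ne0$ have $n'$ of smaller degree and drop out. -/
theorem coeff_sumElim_zero {R : Type*} [CommRing R] {F : MvPowerSeries (σ ⊕ σ) R}
    (hF : diagonal F = 0) {n : σ →₀ ℕ}
    (h : ∀ A n' : σ →₀ ℕ, n'.degree < n.degree → coeff (Finsupp.sumElim A n') F = 0) :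
    coeff (Finsupp.sumElim 0 n) F = 0 := by
  have h1 : coeff n (diagonal F) = coeff (Finsupp.sumElim 0 n) F := by
    rw [diagonal, coeff_rename]
    refine Finset.sum_eq_single _ ?_ ?_
    · intro m hm hne
      obtain ⟨A, n', rfl⟩ := exists_sumElim_eq m
      rw [Set.Finite.mem_toFinset, Set.mem_preimage, Set.mem_singleton_iff,
        mapDomain_sumElim] at hm
      apply h
      rw [← hm, map_add]
      have hA : A ≠ 0 := by
        rintro rfl
        rw [zero_add] at hm
        exact hne (by rw [hm])
      have : A.degree ≠ 0 := fun h0 => hA ((Finsupp.degree_eq_zero_iff A).mp h0)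
      omega
    · intro hm
      exfalso
      apply hm
      rw [Set.Finite.mem_toFinset, Set.mem_preimage, Set.mem_singleton_iff, mapDomain_sumElim,
        zero_add]
  rw [← h1, hF, map_zero]

/-- A family of series in two sets of variables vanishes if its members vanish on the diagonal
and their derivatives with respect to the first set of variables are linear combinations of the
members with coefficients depending on the first set of variables. -/
theorem eq_zero_of_diagonal_eq_zero {ι : Type*} {F : ι → MvPowerSeries (σ ⊕ σ) ℂ}
    (hF : ∀ x, diagonal (F x) = 0)
    (hD : ∀ x i, ∃ (T : Finset ι) (b : ι → MvPowerSeries σ ℂ),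
      pderiv ℂ (Sum.inl i) (F x) =
        ∑ y ∈ T, rename (Function.Embedding.inl : σ ↪ σ ⊕ σ) (b y) * F y) (x : ι) :
    F x = 0 := by
  classical
  -- Double induction: outer on the degree in the second variables, inner on the degree in the
  -- first, uniformly in the member of the family. The diagonal settles `A = 0`; for `A ≠ 0` a
  -- derivative in a variable of `A` reduces to smaller first degree.
  have key : ∀ (d : ℕ) (n : σ →₀ ℕ), n.degree = d → ∀ (k : ℕ) (A : σ →₀ ℕ), A.degree = k →
      ∀ x, coeff (Finsupp.sumElim A n) (F x) = 0 := by
    intro d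
    induction d using Nat.strong_induction_on with
    | _ d ihd =>
    intro n hn k
    induction k using Nat.strong_induction_on with
    | _ k ihk =>
    intro A hA x
    by_cases h0 : A = 0
    · subst h0
      exact coeff_sumElim_zero (hF x) fun A' n' hn' => ihd _ (hn ▸ hn') n' rfl _ A' rfl x
    · obtain ⟨i, hi⟩ := Finsupp.ne_iff.mp h0
      have hA' : A - Finsupp.single i 1 + Finsupp.single i 1 = A :=
        tsub_add_cancel_of_le (Finsupp.single_le_iff.mpr (Nat.one_le_iff_ne_zero.mpr hi))
      obtain ⟨T, b, hT⟩ := hD x i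
      have h1 : coeff (Finsupp.sumElim (A - Finsupp.single i 1) n)
          (pderiv ℂ (Sum.inl i) (F x)) = 0 := by
        rw [hT, map_sum]
        refine Finset.sum_eq_zero fun y _ => coeff_rename_inl_mul_eq_zero (fun B hB => ?_) _
        refine ihk B.degree ?_ B rfl y
        have h2 : B.degree ≤ (A - Finsupp.single i 1).degree := Finsupp.degree_mono hB
        have h3 : (A - Finsupp.single i 1).degree + 1 = A.degree := by
          conv_rhs => rw [← hA', map_add, Finsupp.degree_single]
        omega
      have h4 : Finsupp.sumElim (A - Finsupp.single i 1) n + Finsupp.single (Sum.inl i) 1 =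
          Finsupp.sumElim A n := by
        rw [← Function.Embedding.inl_apply, ← Finsupp.mapDomain_single, mapDomain_inl,
          sumElim_add, add_zero, hA']
      rw [coeff_pderiv, h4] at h1
      exact (mul_eq_zero.mp h1).resolve_right (Nat.cast_add_one_ne_zero _)
  ext m
  obtain ⟨A, n, rfl⟩ := exists_sumElim_eq m
  exact key _ n rfl _ A rfl x

end Vanishing

open DiffOp

/-! ### From operator identities to identities for wave functions -/

section Waves

variable {N : ℕ}

/-- The wave function with coefficients `c` and with exponential factors given by `φ`. -/
def wave (ε : ℤ) (φ : Fin N → Fin N ⊕ Fin N) (c : ℕ → Lat N → Mat N) (α β : Fin N) (s : Lat N) :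
    ZFn (Times N) :=
  zSeries (fun j => c j s α β) * zpow (ε * s β) * expZ (xiVar (φ β))

/-- The adjoint wave function with coefficients `d`. -/
def adjointWave (ε : ℤ) (φ : Fin N → Fin N ⊕ Fin N) (d : ℕ → Lat N → Mat N) (α β : Fin N)
    (s : Lat N) : ZFn (Times N) :=
  zSeries (fun j => d j s α β) * zpow (-(ε * s α)) * expZ (-xiVar (φ α))

variable {ε : ℤ} {φ : Fin N → Fin N ⊕ Fin N} {c d : ℕ → Lat N → Mat N}

theorem extend_apply (c : ℕ → Mat N) (n : ℤ) (α β : Fin N) :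
    extend c n α β = extend (fun j => c j α β) n := by
  unfold extend
  split_ifs <;> rfl

/-- Shifting $s$ by $a+k\boldsymbol 1$ multiplies $z^{\varepsilon s_\beta}$ by
$z^{\varepsilon(a_\beta+k)}$; this is the index offset in the hypothesis. It translates the action
on coefficients into the action on wave functions. -/
theorem sum_ofFn_mul_wave {K : Finset ℤ} {B : ℤ → Mat N} {a s : Lat N} {α β : Fin N}
    {F : ZFn (Times N)}
    (hF : ∀ m, zcoeff m F = ∑ k ∈ K, ∑ δ, B k α δ *
      extend (fun j => c j (s + (a + diagVec N k)) δ β) (m + ε * (a β + k))) :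
    F * zpow (ε * s β) * expZ (xiVar (φ β)) =
      ∑ k ∈ K, ∑ δ, ofFn (B k α δ) * wave ε φ c δ β (s + (a + diagVec N k)) := by
  have h : F = ∑ k ∈ K, ∑ δ, ofFn (B k α δ) * (zpow (ε * (a β + k)) *
      zSeries fun j => c j (s + (a + diagVec N k)) δ β) := by
    apply ext_zcoeff
    intro m
    simp only [hF, map_sum, zcoeff_ofFn_mul, zcoeff_zpow_mul, zcoeff_zSeries]
  rw [h]
  simp only [Finset.sum_mul, wave]
  refine Finset.sum_congr rfl fun k _ => Finset.sum_congr rfl fun δ _ => ?_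
  have h2 : ε * (s + (a + diagVec N k)) β = ε * (a β + k) + ε * s β := by
    simp only [Pi.add_apply, diagVec]
    ring
  rw [h2, zpow_add]
  ring

/-- Differentiating $e^{\xi}$ gives a factor $z^n$ if the time belongs to the family of column `β`.
That contribution cancels `X`, the dressing term in the equation for the wave operator, and leaves
the action of `A` alone. -/
theorem pderiv_wave [Nonempty (Fin N)] (hε : ε * ε = 1) {i : Times N} {A X : DiffOp N}
    {K : Finset ℤ} (hA : ∀ v s, A v s ≠ 0 → ∃ k ∈ K, v = 0 + diagVec N k)
    (h : tderiv i (series ε c) = A * series ε c - X)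
    (hX : ∀ n s α β, X (diagVec N (-(ε * n))) s α β =
      if i.1 = φ β then extend (fun j => c j s α β) (n + i.2) else 0)
    (α β : Fin N) (s : Lat N) :
    pderiv (LaurentSeries ℂ) i (wave ε φ c α β s) = ∑ k ∈ K, ∑ δ,
      ofFn (A (0 + diagVec N k) s α δ) * wave ε φ c δ β (s + (0 + diagVec N k)) := by
  have hw : pderiv (LaurentSeries ℂ) i (wave ε φ c α β s) =
      (zSeries (fun j => pderiv ℂ i (c j s α β)) + (if i.1 = φ β then zpow i.2 else 0) *
        zSeries (fun j => c j s α β)) * zpow (ε * s β) * expZ (xiVar (φ β)) := by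
    rw [wave, Derivation.leibniz, Derivation.leibniz, pderiv_expZ (constantCoeff_xiVar _),
      pderiv_xiVar, pderiv_zpow, pderiv_zSeries]
    simp only [smul_eq_mul]
    ring
  rw [hw]
  refine sum_ofFn_mul_wave fun m => ?_
  have h1 := congrFun (congrFun (congrFun (congrFun h (0 + diagVec N (-(ε * m)))) s) α) β
  rw [sub_apply, Matrix.sub_apply, mul_series_apply hε hA, tderiv, Matrix.map_apply, zero_add, hX,
    series_apply hε, extend_apply] at h1
  have h2 : zcoeff m (zSeries fun j => pderiv ℂ i (c j s α β)) =
      pderiv ℂ i (extend (fun j => c j s α β) m) := by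
    rw [← pderiv_zSeries, zcoeff_pderiv, zcoeff_zSeries]
  have h3 : zcoeff m ((if i.1 = φ β then zpow i.2 else 0) * zSeries fun j => c j s α β) =
      if i.1 = φ β then extend (fun j => c j s α β) (m + i.2) else 0 := by
    split_ifs
    · rw [zcoeff_zpow_mul, zcoeff_zSeries]
    · rw [zero_mul, map_zero]
  rw [map_add, h2, h1, h3, sub_add_cancel, Matrix.sum_apply]
  simp only [Matrix.mul_apply, extend_apply, Pi.zero_apply, zero_add]

/-- In column $a$ the factor $z^{-\varepsilon}$ produced by $e^{-\partial_{s_a}}$ is compensated by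
the extra $e^{\partial_s}$; the other columns see neither. So `A` fixes the full wave function. -/
theorem wave_eq_sum [Nonempty (Fin N)] (hε : ε * ε = 1) {a : Fin N} {A H : DiffOp N}
    {K : Finset ℤ} (hA : ∀ v s, A v s ≠ 0 → ∃ k ∈ K, v = -unitVec a + diagVec N k)
    (h : A * series ε c = H)
    (hH : ∀ n s, H (-unitVec a + diagVec N (-(ε * n))) s =
      extend (fun j => c j s) n * (1 - diagUnit a) + extend (fun j => c j s) (n + ε) * diagUnit a)
    (α β : Fin N) (s : Lat N) :
    wave ε φ c α β s = ∑ k ∈ K, ∑ δ, ofFn (A (-unitVec a + diagVec N k) s α δ) *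
      wave ε φ c δ β (s + (-unitVec a + diagVec N k)) := by
  rw [wave]
  refine sum_ofFn_mul_wave fun m => ?_
  -- Chosen so that $m=n+\varepsilon$ in column $a$ and $m=n$ in the others, matching the two terms
  -- of `hH`.
  set n := m - ε * unitVec a β with hn
  have h1 := congrFun (congrFun (congrFun (congrFun h (-unitVec a + diagVec N (-(ε * n)))) s) α) β
  rw [mul_series_apply hε hA, hH, Matrix.sum_apply] at h1
  have h2 : ∀ k : ℤ, m + ε * ((-unitVec a) β + k) = n + ε * k := fun k => by
    rw [hn, Pi.neg_apply]
    ring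
  simp only [Matrix.mul_apply, extend_apply] at h1
  simp only [h2, zcoeff_zSeries]
  rw [h1, Matrix.add_apply, mul_sub, mul_one, Matrix.sub_apply, diagUnit]
  by_cases hβ : β = a
  · subst hβ
    rw [Matrix.mul_single_apply_same, Matrix.mul_single_apply_same, mul_one, mul_one, sub_self,
      zero_add, extend_apply]
    congr 1
    simp [hn]
  · rw [Matrix.mul_single_apply_of_ne _ _ _ _ _ hβ, Matrix.mul_single_apply_of_ne _ _ _ _ _ hβ,
      sub_zero, add_zero, extend_apply]
    congr 1
    simp [hn, hβ]

end Waves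

variable {N : ℕ}

/-! ### The dressed form of condition (c) -/

section Operators

theorem DiffOp.sum_apply {ι : Type*} (T : Finset ι) (A : ι → DiffOp N) (v s : Lat N) :
    (∑ i ∈ T, A i) v s = ∑ i ∈ T, A i v s := by
  classical
  induction T using Finset.induction_on with
  | empty => rfl
  | insert i T hi ih => rw [Finset.sum_insert hi, Finset.sum_insert hi, add_apply, ih]

variable [Nonempty (Fin N)] {ε : ℤ} {c : ℕ → Lat N → Mat N}

/-- Moving the dressing series to the left turns `Q`, `U b` and `M` into their bare forms. It is
applied with `M` equal to $L$ for $\varepsilon=1$ and to $\bar L^{-1}$ for $\varepsilon=-1$; both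
dress $e^{\partial_s}$. -/
theorem shift_relation (hε : ε * ε = 1) {a : Fin N} {Q M : DiffOp N} {U : Fin N → DiffOp N}
    (hQ : ShiftsLE ε (-unitVec a) 0 Q) (hU : ∀ b, ShiftsLE ε 0 0 (U b)) (hM : ShiftsLE ε 0 1 M)
    (hQc : Q * series ε c = series ε c * shiftOp (-unitVec a))
    (hUc : ∀ b, U b * series ε c = series ε c * ofMat (diagUnit b))
    (hMc : M * series ε c = series ε c * shiftOp (diagVec N 1)) :
    Q * (∑ b, U b * (if a = b then M else 1)) * series ε c =
      ∑ b, series ε c * shiftOp (-unitVec a) * ofMat (diagUnit b) *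
        (if a = b then shiftOp (diagVec N 1) else 1) := by
  have hc : ShiftsLE ε 0 0 (series ε c) := ShiftsLE.series ε c
  have hS : ∀ b, ShiftsLE ε 0 1 (if a = b then shiftOp (diagVec N 1) else 1) := by
    intro b
    split_ifs
    · exact (ShiftsLE.shiftOp_diagVec hε 1).mono (by nlinarith)
    · exact ShiftsLE.one.mono zero_le_one
  have hM' : ∀ b, ShiftsLE ε 0 1 (if a = b then M else 1) := by
    intro b
    split_ifs
    · exact hM
    · exact ShiftsLE.one.mono zero_le_one
  have hE : ∀ b : Fin N, ShiftsLE ε 0 0 (ofMat (diagUnit b)) := fun b => ShiftsLE.ofMat _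
  have hUM : ∀ b, ShiftsLE ε 0 1 (U b * (if a = b then M else 1)) := fun b => by
    simpa using (hU b).mul (hM' b)
  have hES : ∀ b : Fin N, ShiftsLE ε 0 1
      (ofMat (diagUnit b) * (if a = b then shiftOp (diagVec N 1) else 1)) := fun b => by
    simpa using (hE b).mul (hS b)
  have h1 : (∑ b, U b * (if a = b then M else 1)) * series ε c = series ε c *
      ∑ b, ofMat (diagUnit b) * (if a = b then shiftOp (diagVec N 1) else 1) := by
    rw [ShiftsLE.sum_mul hε hUM hc, ShiftsLE.mul_sum hε hc hES]
    refine Finset.sum_congr rfl fun b _ => ?_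
    have h2 : (if a = b then M else 1) * series ε c =
        series ε c * (if a = b then shiftOp (diagVec N 1) else 1) := by
      split_ifs
      · exact hMc
      · rw [one_mul', mul_one']
    rw [(hU b).mul_assoc hε (hM' b) hc, h2, ← (hU b).mul_assoc hε hc (hS b), hUc,
      hc.mul_assoc hε (hE b) (hS b)]
  rw [hQ.mul_assoc hε (ShiftsLE.sum hUM) hc, h1, ← hQ.mul_assoc hε hc (ShiftsLE.sum hES), hQc,
    (hc.mul (ShiftsLE.shiftOp _)).mul_sum hε hES]
  exact Finset.sum_congr rfl fun b _ =>
    ((hc.mul (ShiftsLE.shiftOp _)).mul_assoc hε (hE b) (hS b)).symm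

theorem shift_relation_apply (hε : ε * ε = 1) (a : Fin N) (n : ℤ) (s : Lat N) :
    (∑ b, series ε c * shiftOp (-unitVec a) * ofMat (diagUnit b) *
        (if a = b then shiftOp (diagVec N 1) else 1)) (-unitVec a + diagVec N (-(ε * n))) s =
      extend (fun j => c j s) n * (1 - diagUnit a) + extend (fun j => c j s) (n + ε) * diagUnit a := by
  -- Written as a term common to all `b` plus a correction at `b = a`, so that $\sum_b E_b=1$ can be
  -- used.
  have h1 : ∀ b, (series ε c * shiftOp (-unitVec a) * ofMat (diagUnit b) *
        (if a = b then shiftOp (diagVec N 1) else 1)) (-unitVec a + diagVec N (-(ε * n))) s =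
      extend (fun j => c j s) n * diagUnit b + if a = b then
        (extend (fun j => c j s) (n + ε) - extend (fun j => c j s) n) * diagUnit b else 0 := by
    intro b
    split_ifs
    · have h2 : -unitVec a + diagVec N (-(ε * n)) - diagVec N 1 - -unitVec a =
          diagVec N (-(ε * (n + ε))) := by
        rw [mul_add, hε]
        ext
        simp only [diagVec, Pi.sub_apply, Pi.add_apply]
        ring
      rw [mul_shiftOp_apply, mul_ofMat_apply, mul_shiftOp_apply, h2, series_apply hε, sub_mul]
      abel
    · rw [mul_one', mul_ofMat_apply, mul_shiftOp_apply, add_sub_cancel_left, series_apply hε,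
        add_zero]
  have h3 : ∑ b : Fin N, diagUnit b = (1 : Mat N) := by
    simp only [diagUnit]
    exact Matrix.sum_single_one
  rw [DiffOp.sum_apply]
  simp only [h1, Finset.sum_add_distrib, ← Finset.mul_sum, h3, Finset.sum_ite_eq,
    Finset.mem_univ, if_true]
  rw [mul_sub, sub_mul]
  abel

end Operators

/-! ### The residue pairing and its value at equal times -/

section Pairing

/-- The residue pairing of a row of wave functions with a column of adjoint wave functions. -/
def pairing (G : Fin N → ZFn2 N) (f : Fin N → ZFn (Times N)) : MvPowerSeries (Times N ⊕ Times N) ℂ :=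
  ∑ γ, zcoeff 1 (G γ * inFst (f γ))

/-- Functions of the unprimed times do not involve $z$ and pass through the residue. -/
theorem pairing_sum {ι : Type*} (G : Fin N → ZFn2 N) (T : Finset ι) (b : ι → Fn N)
    (f : ι → Fin N → ZFn (Times N)) :
    pairing G (fun γ => ∑ x ∈ T, ofFn (b x) * f x γ) =
      ∑ x ∈ T, rename (Function.Embedding.inl : Times N ↪ Times N ⊕ Times N) (b x) *
        pairing G (f x) := by
  have h : ∀ γ, inFst (∑ x ∈ T, ofFn (b x) * f x γ) = ∑ x ∈ T,
      ofFn (rename (Function.Embedding.inl : Times N ↪ Times N ⊕ Times N) (b x)) *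
        inFst (f x γ) := by
    intro γ
    rw [inFst_eq, map_sum]
    refine Finset.sum_congr rfl fun x _ => ?_
    rw [map_mul, rename_ofFn, inFst_eq]
  simp only [pairing, h, Finset.mul_sum, map_sum]
  rw [Finset.sum_comm]
  refine Finset.sum_congr rfl fun x _ => Finset.sum_congr rfl fun γ _ => ?_
  rw [mul_left_comm, zcoeff_ofFn_mul]

theorem pderiv_pairing {G : Fin N → ZFn2 N} {i : Times N}
    (hG : ∀ γ, pderiv (LaurentSeries ℂ) (Sum.inl i) (G γ) = 0) (f : Fin N → ZFn (Times N)) :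
    pderiv ℂ (Sum.inl i) (pairing G f) =
      pairing G fun γ => pderiv (LaurentSeries ℂ) i (f γ) := by
  simp only [pairing, map_sum, ← zcoeff_pderiv]
  refine Finset.sum_congr rfl fun γ _ => ?_
  rw [Derivation.leibniz, hG, smul_zero, add_zero, pderiv_inl_inFst, smul_eq_mul]

/-- The column of adjoint wave functions that enters the bilinear equation. -/
def adjointColumn (ε : ℤ) (φ : Fin N → Fin N ⊕ Fin N) (d : ℕ → Lat N → Mat N) (β : Fin N)
    (s' : Lat N) (γ : Fin N) : ZFn2 N :=
  zpow (ε - 1) * inSnd (adjointWave ε φ d γ β s')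

theorem pderiv_adjointColumn (ε : ℤ) (φ : Fin N → Fin N ⊕ Fin N) (d : ℕ → Lat N → Mat N)
    (β : Fin N) (s' : Lat N) (γ : Fin N) (i : Times N) :
    pderiv (LaurentSeries ℂ) (Sum.inl i) (adjointColumn ε φ d β s' γ) = 0 := by
  rw [adjointColumn, Derivation.leibniz, pderiv_inl_inSnd, pderiv_zpow, smul_zero, smul_zero,
    add_zero]

theorem adjointWave_mul_wave (ε : ℤ) (φ : Fin N → Fin N ⊕ Fin N) (c d : ℕ → Lat N → Mat N)
    (α β γ : Fin N) (s' : Lat N) (k : ℤ) :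
    adjointWave ε φ d γ β s' * wave ε φ c α γ (s' + diagVec N k) =
      zpow (ε * k) * (zSeries (fun j => c j (s' + diagVec N k) α γ) *
        zSeries (fun j => d j s' γ β)) := by
  have h : (zpow (ε * k) : ZFn (Times N)) =
      zpow (-(ε * s' γ)) * zpow (ε * (s' + diagVec N k) γ) := by
    rw [← zpow_add]
    congr 1
    simp only [Pi.add_apply, diagVec]
    ring
  rw [adjointWave, wave, h]
  linear_combination (zSeries (fun j => d j s' γ β) * zSeries (fun j => c j (s' + diagVec N k) α γ) *
    zpow (-(ε * s' γ)) * zpow (ε * (s' + diagVec N k) γ)) *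
      expZ_mul_expZ_neg (constantCoeff_xiVar (φ γ))

/-- At equal times the residue is the coefficient of $e^{-(k+1)\partial_s}$, at $s'+k\boldsymbol 1$,
in the product of the wave operator and its inverse, which is the identity. -/
theorem diagonal_pairing [Nonempty (Fin N)] {ε : ℤ} (hε : ε * ε = 1)
    (φ : Fin N → Fin N ⊕ Fin N) {c d : ℕ → Lat N → Mat N}
    (h : series ε c * series ε (fun j s => d j (s + diagVec N (1 - ε * j))) = 1)
    (α β : Fin N) (s' : Lat N) (k : ℤ) :
    diagonal (pairing (adjointColumn ε φ d β s') fun γ => wave ε φ c α γ (s' + diagVec N k)) =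
      if k = -1 then (1 : Mat N) α β else 0 := by
  have h1 : ∀ γ, diagonal (zcoeff 1 (adjointColumn ε φ d β s' γ *
      inFst (wave ε φ c α γ (s' + diagVec N k)))) =
        extend (fun n => ∑ p ∈ Finset.HasAntidiagonal.antidiagonal n,
          c p.1 (s' + diagVec N k) α γ * d p.2 s' γ β) (ε * (k + 1)) := by
    intro γ
    have h2 : zcoeff 1 (diagonal (adjointColumn ε φ d β s' γ *
        inFst (wave ε φ c α γ (s' + diagVec N k)))) = diagonal (zcoeff 1
          (adjointColumn ε φ d β s' γ * inFst (wave ε φ c α γ (s' + diagVec N k)))) :=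
      zcoeff_rename _ _ _
    have h3 : diagonal (adjointColumn ε φ d β s' γ * inFst (wave ε φ c α γ (s' + diagVec N k))) =
        zpow (ε - 1) * (adjointWave ε φ d γ β s' * wave ε φ c α γ (s' + diagVec N k)) := by
      rw [adjointColumn, inFst_eq, inSnd_eq, map_mul, map_mul, diagonal_rename_inl,
        diagonal_rename_inr, mul_assoc]
      exact congrArg (· * _) (rename_zpow _ _)
    -- The residue index 1, the factor $z^{\varepsilon-1}$ and the factor $z^{\varepsilon k}$ add up
    -- to $\varepsilon(k+1)$.
    rw [← h2, h3, adjointWave_mul_wave, zcoeff_zpow_mul, zcoeff_zpow_mul,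
      zcoeff_zSeries_mul_zSeries]
    congr 1
    ring
  rw [pairing, map_sum]
  simp only [h1]
  have hε0 : ε ≠ 0 := left_ne_zero_of_mul (hε.trans_ne one_ne_zero)
  obtain ⟨n, hn⟩ | hneg := (le_or_gt 0 (ε * (k + 1))).imp_left Int.eq_ofNat_of_zero_le
  · have hk : k + 1 = ε * n := by rw [← hn, ← mul_assoc, hε, one_mul]
    have h3 := congrFun (congrFun (congrFun (congrFun h (diagVec N (-(ε * n))))
      (s' + diagVec N k)) α) β
    rw [series_mul_series_apply hε, Matrix.sum_apply, one_def, ofMat] at h3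
    have h4 : ∀ p ∈ Finset.HasAntidiagonal.antidiagonal n,
        (c p.1 (s' + diagVec N k) * d p.2 (s' + diagVec N k + diagVec N (-(ε * p.1)) +
          diagVec N (1 - ε * p.2))) α β = ∑ γ, c p.1 (s' + diagVec N k) α γ * d p.2 s' γ β := by
      intro p hp
      have hp : ((p.1 : ℤ) + p.2) = n := by
        exact_mod_cast Finset.HasAntidiagonal.mem_antidiagonal.mp hp
      -- Since $k+1=\varepsilon n$, every coefficient of the inverse is evaluated at the same point
      -- $s'$, as in the adjoint wave function.
      have h5 : s' + diagVec N k + diagVec N (-(ε * p.1)) + diagVec N (1 - ε * p.2) = s' := by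
        ext x
        simp only [Pi.add_apply, diagVec]
        rw [← hp] at hk
        linear_combination hk
      rw [h5, Matrix.mul_apply]
    rw [Finset.sum_congr rfl h4, Finset.sum_comm] at h3
    simp only [hn, extend_natCast]
    rw [h3]
    have h6 : diagVec N (-(ε * n)) = 0 ↔ k = -1 := by
      rw [← diagVec_zero, diagVec_injective.eq_iff, ← hk]
      omega
    simp only [h6]
    split_ifs <;> rfl
  · have hk : k ≠ -1 := by
      rintro rfl
      simp at hneg
    simp only [extend_of_neg _ hneg, if_neg hk, Finset.sum_const_zero]

end Pairing

/-! ### The bilinear equation for the wave functions of a solution -/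

section Solutions

/-- The projection cuts off the infinite tail of $L^nU_a$. Having finitely many shifts, the result
can act on series extending in either direction. -/
theorem LaxData.B_support (D : LaxData N) (a : Fin N) (n : ℕ+) (v s : Lat N)
    (h : D.B a n v s ≠ 0) : ∃ k ∈ Finset.Icc (0 : ℤ) n, v = 0 + diagVec N k := by
  classical
  rw [LaxData.B, geZeroPart] at h
  obtain ⟨hj, h⟩ := ite_ne_right_iff.mp h
  obtain ⟨i, hi, hv⟩ := (((ShiftsLE.lower 1 D.b).npow n).mul (ShiftsLE.lower 0 (D.u a))) v s h
  obtain ⟨j, hj⟩ := hj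
  rw [one_mul, add_zero] at hv
  by_cases hN : Nonempty (Fin N)
  · rw [hj, zero_add] at hv
    have := diagVec_injective hv
    exact ⟨i, Finset.mem_Icc.mpr ⟨by omega, by omega⟩, by rw [hj, hv, zero_add]⟩
  · exact (hN ⟨a⟩).elim

theorem LaxData.Bbar_support (D : LaxData N) (a : Fin N) (n : ℕ+) (v s : Lat N)
    (h : D.Bbar a n v s ≠ 0) : ∃ k ∈ Finset.Icc (-n : ℤ) 0, v = 0 + diagVec N k := by
  classical
  rw [LaxData.Bbar, ltZeroPart] at h
  obtain ⟨hj, h⟩ := ite_ne_right_iff.mp h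
  obtain ⟨i, hi, hv⟩ :=
    (((ShiftsLE.upper (-1) D.bbar).npow n).mul (ShiftsLE.upper 0 (D.ubar a))) v s h
  obtain ⟨j, hj⟩ := hj
  rw [add_zero] at hv
  by_cases hN : Nonempty (Fin N)
  · rw [hj, zero_add] at hv
    have := diagVec_injective hv
    exact ⟨-(j + 1), Finset.mem_Icc.mpr ⟨by omega, by omega⟩, by rw [hj, zero_add]⟩
  · exact (hN ⟨a⟩).elim

variable {D : LaxData N} {W : WaveData N}

theorem WaveData.hatW_eq (W : WaveData N) : W.hatW = series 1 W.w := lower_zero_eq _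

theorem WaveData.hatWbar_eq (W : WaveData N) : W.hatWbar = series (-1) W.wbar := upper_zero_eq _

theorem series_mul_shiftOp_mul_ofMat [Nonempty (Fin N)] {ε : ℤ} (hε : ε * ε = 1)
    (c : ℕ → Lat N → Mat N) (a : Fin N) (k n : ℤ) (s : Lat N) (α β : Fin N) :
    (series ε c * (shiftOp (diagVec N (ε * k)) * ofMat (diagUnit a))) (diagVec N (-(ε * n))) s α β =
      if a = β then extend (fun j => c j s α β) (n + k) else 0 := by
  have h : diagVec N (-(ε * n)) - diagVec N (ε * k) = diagVec N (-(ε * (n + k))) := by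
    ext
    simp only [diagVec, Pi.sub_apply]
    ring
  rw [← (ShiftsLE.series ε c).mul_assoc hε (ShiftsLE.shiftOp _) (ShiftsLE.ofMat _),
    mul_ofMat_apply, mul_shiftOp_apply, h, series_apply hε, diagUnit]
  split_ifs with hβ
  · subst hβ
    rw [Matrix.mul_single_apply_same, mul_one, extend_apply]
  · rw [Matrix.mul_single_apply_of_ne _ _ _ _ _ (Ne.symm hβ)]

/-- The two wave functions satisfy the same evolution equations. -/
theorem WaveData.IsWave.exists_evolution [Nonempty (Fin N)] (hW : W.IsWave D) (i : Times N) :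
    ∃ (K : Finset ℤ) (B : ℤ → Lat N → Mat N), ∀ α β s,
      pderiv (LaurentSeries ℂ) i (wave 1 Sum.inl W.w α β s) = ∑ k ∈ K, ∑ δ,
        ofFn (B k s α δ) * wave 1 Sum.inl W.w δ β (s + (0 + diagVec N k)) ∧
      pderiv (LaurentSeries ℂ) i (wave (-1) Sum.inr W.wbar α β s) = ∑ k ∈ K, ∑ δ,
        ofFn (B k s α δ) * wave (-1) Sum.inr W.wbar δ β (s + (0 + diagVec N k)) := by
  obtain ⟨a | a, n⟩ := i
  · refine ⟨Finset.Icc 0 n, fun k s => D.B a n (0 + diagVec N k) s, fun α β s => ⟨?_, ?_⟩⟩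
    · refine pderiv_wave (one_mul 1) (D.B_support a n)
        ((congrArg _ W.hatW_eq).symm.trans ((hW.deriv_W a n).trans
          (by rw [W.hatW_eq]))) (fun m s α β => ?_) α β s
      have := series_mul_shiftOp_mul_ofMat (one_mul 1) W.w a n m s α β
      rw [one_mul (n : ℤ)] at this
      simpa only [Sum.inl.injEq] using this
    -- The exponential factor of the barred wave function does not contain this time, so there is no
    -- dressing term.
    · refine pderiv_wave (X := 0) (by norm_num) (D.B_support a n)
        ((congrArg _ W.hatWbar_eq).symm.trans ((hW.deriv_Wbar a n).trans
          (by rw [W.hatWbar_eq, sub_zero]))) (fun m s α β => ?_) α β s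
      rw [if_neg (by simp)]
      rfl
  · refine ⟨Finset.Icc (-n) 0, fun k s => D.Bbar a n (0 + diagVec N k) s, fun α β s => ⟨?_, ?_⟩⟩
    · refine pderiv_wave (X := 0) (one_mul 1) (D.Bbar_support a n)
        ((congrArg _ W.hatW_eq).symm.trans ((hW.derivbar_W a n).trans
          (by rw [W.hatW_eq, sub_zero]))) (fun m s α β => ?_) α β s
      rw [if_neg (by simp)]
      rfl
    · refine pderiv_wave (by norm_num) (D.Bbar_support a n)
        ((congrArg _ W.hatWbar_eq).symm.trans ((hW.derivbar_Wbar a n).trans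
          (by rw [W.hatWbar_eq]))) (fun m s α β => ?_) α β s
      have := series_mul_shiftOp_mul_ofMat (by norm_num : (-1 : ℤ) * -1 = 1) W.wbar a n m s α β
      rw [neg_one_mul (n : ℤ)] at this
      simpa only [Sum.inr.injEq] using this

/-- The two wave functions satisfy the same difference equations in the discrete variables. -/
theorem WaveData.IsWave.exists_shift [Nonempty (Fin N)] (hD : D.IsSolution) (hW : W.IsWave D)
    (a : Fin N) :
    ∃ (K : Finset ℤ) (B : ℤ → Lat N → Mat N), ∀ α β s,
      wave 1 Sum.inl W.w α β s = ∑ k ∈ K, ∑ δ,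
        ofFn (B k s α δ) * wave 1 Sum.inl W.w δ β (s + (-unitVec a + diagVec N k)) ∧
      wave (-1) Sum.inr W.wbar α β s = ∑ k ∈ K, ∑ δ,
        ofFn (B k s α δ) * wave (-1) Sum.inr W.wbar δ β (s + (-unitVec a + diagVec N k)) := by
  obtain ⟨m, ⟨hm1, hm2⟩, hA⟩ := hD.basis
  have hε : (1 : ℤ) * 1 = 1 := one_mul 1
  have hε' : (-1 : ℤ) * -1 = 1 := by norm_num
  have hQ : ShiftsLE 1 (-unitVec a) 0 (D.Q a) := by
    simpa using! (ShiftsLE.shiftOp (-unitVec a)).mul (ShiftsLE.lower 0 (D.p a))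
  have hQbar : ShiftsLE (-1) (-unitVec a) 0 (D.Qbar a) := by
    simpa using! (ShiftsLE.shiftOp (-unitVec a)).mul (ShiftsLE.upper 0 (D.pbar a))
  have hU : ∀ b, ShiftsLE 1 0 0 (D.U b) := fun b => ShiftsLE.lower 0 _
  have hUbar : ∀ b, ShiftsLE (-1) 0 0 (D.Ubar b) := fun b => ShiftsLE.upper 0 _
  have hL : ShiftsLE 1 0 1 D.L := ShiftsLE.lower 1 _
  have hLbar : ShiftsLE (-1) 0 1 D.Lbar := ShiftsLE.upper (-1) _
  have hLinv : ShiftsLE (-1) 0 0 (upper 1 m) := (ShiftsLE.upper 1 m).mono (by norm_num)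
  have hWbar := ShiftsLE.series (-1) W.wbar
  -- From $\bar L\bar W=\bar We^{-\partial_s}$: multiply by $\bar L^{-1}$ on the left, then undo the
  -- right shift by reading the coefficient at $v-\boldsymbol 1$.
  have hLinvW : upper 1 m * series (-1) W.wbar =
      series (-1) W.wbar * shiftOp (diagVec N 1) := by
    have h1 : series (-1) W.wbar =
        upper 1 m * series (-1) W.wbar * shiftOp (diagVec N (-1)) := by
      rw [hLinv.mul_assoc hε' hWbar (ShiftsLE.shiftOp _), ← W.hatWbar_eq, ← hW.Lbar_Wbar,
        W.hatWbar_eq, ← hLinv.mul_assoc hε' hLbar hWbar, hm2, one_mul']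
    ext1 v s
    have h2 := congrFun (congrFun h1 (v - diagVec N 1)) s
    rw [mul_shiftOp_apply] at h2
    rw [mul_shiftOp_apply, h2, show v - diagVec N 1 - diagVec N (-1) = v by
      ext
      simp only [diagVec, Pi.sub_apply]
      ring]
  set A := D.Q a * ∑ β, D.U β * (if a = β then D.L else 1) with hAdef
  have hA1 : ShiftsLE 1 (-unitVec a) 1 A := by
    have h1 : ShiftsLE 1 0 1 (∑ β, D.U β * (if a = β then D.L else 1)) := by
      refine ShiftsLE.sum fun b => ?_
      split_ifs
      · simpa using (hU b).mul hL
      · simpa using ((hU b).mul ShiftsLE.one).mono zero_le_one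
    simpa only [add_zero, zero_add] using hQ.mul h1
  have hA2 : ShiftsLE (-1) (-unitVec a) 0 A := by
    rw [hAdef, hA a]
    have h1 : ShiftsLE (-1) 0 0 (∑ β, D.Ubar β * (if a = β then upper 1 m else 1)) := by
      refine ShiftsLE.sum fun b => ?_
      split_ifs
      · simpa using (hUbar b).mul hLinv
      · simpa using (hUbar b).mul ShiftsLE.one
    simpa only [add_zero, zero_add] using hQbar.mul h1
  -- The unbarred form of `A` bounds the multiple of $\boldsymbol 1$ above by 1, the barred form
  -- bounds it below by 0.
  have hsupp : ∀ v s, A v s ≠ 0 →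
      ∃ k ∈ Finset.Icc (0 : ℤ) 1, v = -unitVec a + diagVec N k := by
    intro v s hv
    obtain ⟨i, hi, h1⟩ := hA1 v s hv
    obtain ⟨j, hj, h2⟩ := hA2 v s hv
    have h3 := diagVec_injective (add_left_cancel (h1.symm.trans h2))
    exact ⟨i, Finset.mem_Icc.mpr ⟨by omega, hi⟩, by rw [h1, one_mul]⟩
  refine ⟨Finset.Icc 0 1, fun k s => A (-unitVec a + diagVec N k) s, fun α β s => ⟨?_, ?_⟩⟩
  · refine wave_eq_sum hε hsupp (shift_relation hε hQ hU hL ?_ (fun b => ?_) ?_)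
      (shift_relation_apply hε a) α β s
    · rw [← W.hatW_eq, hW.Q_W]
    · rw [← W.hatW_eq, hW.U_W]
    · rw [← W.hatW_eq, hW.L_W]
  · refine wave_eq_sum hε' hsupp ((congrArg (· * _) (hA a)).trans
      (shift_relation hε' hQbar hUbar (hLinv.mono zero_le_one) ?_ (fun b => ?_) hLinvW))
      (shift_relation_apply hε' a) α β s
    · rw [← W.hatWbar_eq, hW.Qbar_Wbar]
    · rw [← W.hatWbar_eq, hW.Ubar_Wbar]

theorem WaveData.IsWave.series_mul_series (hW : W.IsWave D) :
    series 1 W.w * series 1 (fun j s => W.wstar j (s + diagVec N (1 - 1 * j))) = 1 := by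
  simp only [one_mul]
  rw [← W.hatW_eq, ← lower_zero_eq]
  exact hW.inv_W.1

theorem WaveData.IsWave.series_mul_series_bar (hW : W.IsWave D) :
    series (-1) W.wbar * series (-1) (fun j s => W.wbarstar j (s + diagVec N (1 - -1 * j))) = 1 := by
  simp only [neg_one_mul, sub_neg_eq_add]
  rw [← W.hatWbar_eq, ← upper_zero_eq]
  exact hW.inv_Wbar.1

/-- The difference of the two sides of the bilinear equation for the wave functions. -/
def WaveData.bilinear (W : WaveData N) (β : Fin N) (s' : Lat N) (α : Fin N) (s : Lat N) :
    MvPowerSeries (Times N ⊕ Times N) ℂ :=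
  pairing (adjointColumn 1 Sum.inl W.wstar β s') (fun γ => wave 1 Sum.inl W.w α γ s) -
    pairing (adjointColumn (-1) Sum.inr W.wbarstar β s') fun γ => wave (-1) Sum.inr W.wbar α γ s

theorem WaveData.IsWave.diagonal_bilinear [Nonempty (Fin N)] (hW : W.IsWave D) (α β : Fin N)
    (s' : Lat N) (k : ℤ) : diagonal (W.bilinear β s' α (s' + diagVec N k)) = 0 := by
  rw [WaveData.bilinear, map_sub, diagonal_pairing (one_mul 1) _ hW.series_mul_series,
    diagonal_pairing (by norm_num) _ hW.series_mul_series_bar, sub_self]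

theorem pairing_sum_sum (G : Fin N → ZFn2 N) (K : Finset ℤ) (b : ℤ → Fin N → Fn N)
    (f : ℤ → Fin N → Fin N → ZFn (Times N)) :
    pairing G (fun γ => ∑ k ∈ K, ∑ δ, ofFn (b k δ) * f k δ γ) =
      ∑ k ∈ K, ∑ δ, rename (Function.Embedding.inl : Times N ↪ Times N ⊕ Times N) (b k δ) *
        pairing G (f k δ) := by
  simp only [← Finset.sum_product']
  exact pairing_sum G (K ×ˢ Finset.univ) (fun x => b x.1 x.2) fun x => f x.1 x.2

theorem WaveData.IsWave.pderiv_bilinear [Nonempty (Fin N)] (hW : W.IsWave D) (i : Times N) :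
    ∃ (K : Finset ℤ) (B : ℤ → Lat N → Mat N), ∀ α β s s',
      pderiv ℂ (Sum.inl i) (W.bilinear β s' α s) = ∑ k ∈ K, ∑ δ,
        rename (Function.Embedding.inl : Times N ↪ Times N ⊕ Times N) (B k s α δ) *
          W.bilinear β s' δ (s + (0 + diagVec N k)) := by
  obtain ⟨K, B, h⟩ := hW.exists_evolution i
  refine ⟨K, B, fun α β s s' => ?_⟩
  have h1 := fun γ => (h α γ s).1
  have h2 := fun γ => (h α γ s).2
  rw [WaveData.bilinear, map_sub, pderiv_pairing fun γ => pderiv_adjointColumn _ _ _ _ _ _ _,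
    pderiv_pairing fun γ => pderiv_adjointColumn _ _ _ _ _ _ _]
  simp only [h1, h2, pairing_sum_sum, WaveData.bilinear, mul_sub, Finset.sum_sub_distrib]

theorem WaveData.IsWave.bilinear_eq_sum [Nonempty (Fin N)] (hD : D.IsSolution) (hW : W.IsWave D)
    (a : Fin N) : ∃ (K : Finset ℤ) (B : ℤ → Lat N → Mat N), ∀ α β s s',
      W.bilinear β s' α s = ∑ k ∈ K, ∑ δ,
        rename (Function.Embedding.inl : Times N ↪ Times N ⊕ Times N) (B k s α δ) *
          W.bilinear β s' δ (s + (-unitVec a + diagVec N k)) := by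
  obtain ⟨K, B, h⟩ := hW.exists_shift hD a
  refine ⟨K, B, fun α β s s' => ?_⟩
  have h1 : (fun γ => wave 1 Sum.inl W.w α γ s) = _ := funext fun γ => (h α γ s).1
  have h2 : (fun γ => wave (-1) Sum.inr W.wbar α γ s) = _ := funext fun γ => (h α γ s).2
  rw [WaveData.bilinear, h1, h2]
  simp only [pairing_sum_sum, WaveData.bilinear, mul_sub, Finset.sum_sub_distrib]

/-- The evolution moves $s$ only along $\boldsymbol 1$, so the members on the line $s'+\mathbb
Z\boldsymbol 1$, with all rows, form a family closed under derivatives. -/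
theorem WaveData.IsWave.bilinear_add_diagVec [Nonempty (Fin N)] (hW : W.IsWave D) (α β : Fin N)
    (s' : Lat N) (k : ℤ) : W.bilinear β s' α (s' + diagVec N k) = 0 := by
  refine eq_zero_of_diagonal_eq_zero
    (F := fun x : ℤ × Fin N => W.bilinear β s' x.2 (s' + diagVec N x.1))
    (fun x => hW.diagonal_bilinear x.2 β s' x.1) (fun x i => ?_) (k, α)
  obtain ⟨K, B, h⟩ := hW.pderiv_bilinear i
  refine ⟨(K.image fun l => x.1 + l) ×ˢ Finset.univ,
    fun y => B (y.1 - x.1) (s' + diagVec N x.1) x.2 y.2, ?_⟩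
  rw [h, Finset.sum_product, Finset.sum_image fun _ _ _ _ h => add_left_cancel h]
  refine Finset.sum_congr rfl fun l _ => Finset.sum_congr rfl fun δ _ => ?_
  simp only [add_sub_cancel_left, zero_add, add_assoc, diagVec_add]

/-- The bilinear equation for the wave functions. -/
theorem WaveData.IsWave.bilinear_eq_zero [Nonempty (Fin N)] (hD : D.IsSolution)
    (hW : W.IsWave D) (α β : Fin N) (s s' : Lat N) : W.bilinear β s' α s = 0 := by
  -- The relation for `a` at a point of the line through $x+[1]_a$ involves only points of the line
  -- through $x$.
  have hstep : ∀ (a : Fin N) (x : Lat N), (∀ α k, W.bilinear β s' α (x + diagVec N k) = 0) →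
      ∀ α k, W.bilinear β s' α (x + unitVec a + diagVec N k) = 0 := by
    intro a x hx α k
    obtain ⟨K, B, h⟩ := hW.bilinear_eq_sum hD a
    rw [h]
    refine Finset.sum_eq_zero fun l _ => Finset.sum_eq_zero fun δ _ => ?_
    rw [show x + unitVec a + diagVec N k + (-unitVec a + diagVec N l) = x + diagVec N (k + l) by
      rw [diagVec_add]; abel, hx, mul_zero]
  have hnat : ∀ (n : ℕ) (a : Fin N) (x : Lat N),
      (∀ α k, W.bilinear β s' α (x + diagVec N k) = 0) →
        ∀ α k, W.bilinear β s' α (x + n • unitVec a + diagVec N k) = 0 := by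
    intro n a x hx
    induction n with
    | zero => simpa using hx
    | succ n ih =>
      rw [succ_nsmul, ← add_assoc]
      exact hstep a _ ih
  have hsum : ∀ (v : Fin N → ℕ) (T : Finset (Fin N)) (α : Fin N) (k : ℤ),
      W.bilinear β s' α (s' + ∑ a ∈ T, v a • unitVec a + diagVec N k) = 0 := by
    intro v T
    induction T using Finset.induction_on with
    | empty => simpa using fun α k => hW.bilinear_add_diagVec α β s' k
    | insert a T ha ih =>
      rw [Finset.sum_insert ha, add_comm (v a • _), ← add_assoc]
      exact hnat (v a) a _ ih
  -- The steps only add unit vectors; `M` is large enough to make every $s_a-s'_a+M$ nonnegative,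
  -- and $-M\boldsymbol 1$ is then absorbed in the line direction.
  set M := ∑ a, |s a - s' a| with hM
  have hv : s = s' + ∑ a, (s a - s' a + M).toNat • unitVec a + diagVec N (-M) := by
    ext x
    have h1 : |s x - s' x| ≤ M :=
      Finset.single_le_sum (f := fun a => |s a - s' a|) (fun a _ => abs_nonneg _)
        (Finset.mem_univ x)
    have h2 := neg_abs_le (s x - s' x)
    have h3 : ∑ a, (s a - s' a + M).toNat • unitVec a x = (s x - s' x + M).toNat := by
      simp [Pi.single_apply]
    have h4 : s x = s' x + ∑ a, (s a - s' a + M).toNat • unitVec a x + -M := by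
      rw [h3, Int.toNat_of_nonneg (by linarith)]
      ring
    simpa only [Pi.add_apply, Finset.sum_apply, Pi.smul_apply, diagVec] using h4
  rw [hv]
  exact hsum _ _ α _

end Solutions

/-! ### From wave functions to the tau-function -/

section Tau

theorem xi_tT (γ : Fin N) : xi (tT γ) = xiVar (Sum.inl γ) := rfl

theorem xi_tTbar (γ : Fin N) : xi (tTbar γ) = xiVar (Sum.inr γ) := rfl

theorem Psi_eq (W : WaveData N) (α β : Fin N) (s : Lat N) :
    W.Psi α β s = wave 1 Sum.inl W.w α β s := by
  rw [wave, one_mul]; rfl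

theorem PsiStar_eq (W : WaveData N) (α β : Fin N) (s : Lat N) :
    W.PsiStar α β s = adjointWave 1 Sum.inl W.wstar α β s := by
  rw [adjointWave, one_mul]; rfl

theorem PsiBar_eq (W : WaveData N) (α β : Fin N) (s : Lat N) :
    W.PsiBar α β s = wave (-1) Sum.inr W.wbar α β s := by
  rw [wave, neg_one_mul]; rfl

theorem PsiBarStar_eq (W : WaveData N) (α β : Fin N) (s : Lat N) :
    W.PsiBarStar α β s = adjointWave (-1) Sum.inr W.wbarstar α β s := by
  rw [adjointWave, neg_one_mul, neg_neg]; rfl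

theorem inFst_mul (f g : ZFn (Times N)) : inFst (f * g) = inFst f * inFst g := map_mul _ _ _

theorem inSnd_mul (f g : ZFn (Times N)) : inSnd (f * g) = inSnd f * inSnd g := map_mul _ _ _

theorem inFst_zpow (k : ℤ) : inFst (zpow k : ZFn (Times N)) = zpow k := rename_zpow _ k

theorem inSnd_zpow (k : ℤ) : inSnd (zpow k : ZFn (Times N)) = zpow k := rename_zpow _ k

theorem inFst_ofFn (f : Fn N) : inFst (ofFn f) =
    ofFn (rename (Function.Embedding.inl : Times N ↪ Times N ⊕ Times N) f) := rename_ofFn _ f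

theorem inSnd_ofFn (f : Fn N) : inSnd (ofFn f) =
    ofFn (rename (Function.Embedding.inr : Times N ↪ Times N ⊕ Times N) f) := rename_ofFn _ f

theorem kd_comm (α β : Fin N) : kd α β = kd β α := by
  simp only [kd, eq_comm]

theorem neg_one_pow_mul_mul {R : Type*} [CommRing R] {k : ℕ} {x y : R}
    (h : x = (-1) ^ (k + 1) * y) : (-1) ^ k * y = -x := by
  rw [h, pow_succ]
  ring

variable {W : WaveData N} {τ : Fin N → Fin N → Lat N → Fn N}

theorem oint_ofFn_mul {σ : Type} (a : MvPowerSeries σ ℂ) (F : ZFn σ) :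
    oint (ofFn a * F) = a * oint F := by
  rw [oint_eq, oint_eq, zcoeff_ofFn_mul, mul_left_comm]

theorem oint_neg_one_pow_mul {σ : Type} (k : ℕ) (F : ZFn σ) :
    oint ((-1) ^ k * F) = (-1) ^ k * oint F := by
  rw [← oint_ofFn_mul, map_pow, map_neg, map_one]

theorem oint_neg {σ : Type} (F : ZFn σ) : oint (-F) = -oint F := by
  rw [oint_eq, oint_eq, map_neg, mul_neg]

/-- The product of the diagonal elements of a tau-function that appear as denominators. -/
def tauFactor (τ : Fin N → Fin N → Lat N → Fn N) (α β : Fin N) (s s' : Lat N) :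
    MvPowerSeries (Times N ⊕ Times N) ℂ :=
  rename (Function.Embedding.inl : Times N ↪ Times N ⊕ Times N) (τ α α s) *
    rename (Function.Embedding.inr : Times N ↪ Times N ⊕ Times N) (τ β β s')

/-- The sign of $\Psi^*$ combines with $(-1)^{\delta_{\beta\gamma}}$ to $-1$ for every $\gamma$.
Equality of the diagonal elements replaces the denominator $\tau_{\gamma\gamma}(s')$ by
$\tau_{\beta\beta}(s')$, so the prefactor does not depend on $\gamma$. -/
theorem WaveData.IsTau.oint_eq (hτ : W.IsTau τ) (α β γ : Fin N) (s s' : Lat N) :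
    (-1) ^ kd β γ * oint (zpow (s γ - s' γ + kd α γ + kd β γ - 2) * expXiDiff (Sum.inl γ) *
        inFst (shift (-1) (Sum.inl γ) (τ α γ s)) * inSnd (shift 1 (Sum.inl γ) (τ γ β s'))) =
      -(tauFactor τ α β s s' * oint (adjointColumn 1 Sum.inl W.wstar β s' γ *
        inFst (wave 1 Sum.inl W.w α γ s))) := by
  have h1 := congrArg inFst (hτ.psi α γ s)
  have h2 := congrArg inSnd (hτ.psiStar γ β s')
  rw [Psi_eq, xi_tT, inFst_mul, inFst_mul, inFst_mul, inFst_zpow, inFst_ofFn] at h1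
  rw [PsiStar_eq, xi_tT, mul_assoc, mul_assoc, kd_comm γ β, hτ.diag γ β] at h2
  rw [inSnd_mul, inSnd_mul, inSnd_mul, inSnd_mul, inSnd_zpow, inSnd_ofFn] at h2
  have h3 : inSnd ((-1) ^ (kd β γ + 1) : ZFn (Times N)) = (-1) ^ (kd β γ + 1) := by
    rw [inSnd_eq, map_pow, map_neg, map_one]
  have h4 : (zpow (s γ - s' γ + kd α γ + kd β γ - 2) : ZFn2 N) =
      zpow (s γ + kd α γ - 1) * zpow (-s' γ + kd β γ - 1) := by
    rw [← zpow_add]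
    congr 1
    ring
  rw [h3] at h2
  rw [← oint_neg_one_pow_mul, ← oint_ofFn_mul, ← oint_neg, expXiDiff_eq, h4, tauFactor, map_mul,
    adjointColumn, sub_self, zpow_zero, one_mul]
  congr 1
  have h5 := neg_one_pow_mul_mul h2
  linear_combination inFst (shift (-1) (Sum.inl γ) (τ α γ s)) * zpow (s γ + kd α γ - 1) *
    inFst (expZ (xiVar (Sum.inl γ))) * h5 +
    inSnd (adjointWave 1 Sum.inl W.wstar γ β s') *
      ofFn (rename (Function.Embedding.inr) (τ β β s')) * h1

/-- Here the sign comes from $\bar\Psi$ instead, with the same total $-1$, and $z^{-2}$ is the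
factor $z^{\varepsilon-1}$ of the adjoint column at $\varepsilon=-1$. -/
theorem WaveData.IsTau.oint_bar_eq (hτ : W.IsTau τ) (α β γ : Fin N) (s s' : Lat N) :
    (-1) ^ kd α γ * oint (zpow (s' γ - s γ - 2) * expXiDiff (Sum.inr γ) *
        inFst (shift (-1) (Sum.inr γ) (τ α γ (s + unitVec γ))) *
        inSnd (shift 1 (Sum.inr γ) (τ γ β (s' - unitVec γ)))) =
      -(tauFactor τ α β s s' * oint (adjointColumn (-1) Sum.inr W.wbarstar β s' γ *
        inFst (wave (-1) Sum.inr W.wbar α γ s))) := by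
  have h1 := congrArg inFst (hτ.psiBar α γ s)
  have h2 := congrArg inSnd (hτ.psiBarStar γ β s')
  rw [PsiBar_eq, xi_tTbar, mul_assoc, mul_assoc, inFst_mul, inFst_mul, inFst_mul, inFst_mul, inFst_zpow,
    inFst_ofFn] at h1
  rw [PsiBarStar_eq, xi_tTbar, hτ.diag γ β, inSnd_mul, inSnd_mul, inSnd_mul, inSnd_zpow, inSnd_ofFn] at h2
  have h3 : inFst ((-1) ^ (kd α γ + 1) : ZFn (Times N)) = (-1) ^ (kd α γ + 1) := by
    rw [inFst_eq, map_pow, map_neg, map_one]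
  have h4 : (zpow (s' γ - s γ - 2) : ZFn2 N) = zpow (-1 - 1) * (zpow (-s γ) * zpow (s' γ)) := by
    rw [← zpow_add, ← zpow_add]
    congr 1
    ring
  rw [h3] at h1
  rw [← oint_neg_one_pow_mul, ← oint_ofFn_mul, ← oint_neg, expXiDiff_eq, h4, tauFactor, map_mul,
    adjointColumn]
  congr 1
  have h5 := neg_one_pow_mul_mul h1
  linear_combination zpow (-1 - 1) * inSnd (shift 1 (Sum.inr γ) (τ γ β (s' - unitVec γ))) *
    zpow (s' γ) * inSnd (expZ (-xiVar (Sum.inr γ))) * h5 +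
    zpow (-1 - 1) * ofFn (rename (Function.Embedding.inl) (τ α α s)) *
      inFst (wave (-1) Sum.inr W.wbar α γ s) * h2

theorem oint_sum {σ : Type} (T : Finset (Fin N)) (F : Fin N → ZFn σ) :
    ∑ γ ∈ T, oint (F γ) = C (2 * Real.pi * Complex.I) * ∑ γ ∈ T, zcoeff 1 (F γ) := by
  simp only [Toda.oint_eq, Finset.mul_sum]

end Tau

end Toda

end

/-- The tau-function of the `N`-component Toda lattice hierarchy satisfies the matrix bilinear
equation. -/
theorem mainTheorem2 (N : ℕ) (D : Toda.LaxData N) (hD : D.IsSolution)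
    (W : Toda.WaveData N) (hW : W.IsWave D)
    (τ : Fin N → Fin N → Toda.Lat N → Toda.Fn N) (hτ : W.IsTau τ)
    (α β : Fin N) (s s' : Toda.Lat N) :
    ∑ γ : Fin N, (-1) ^ Toda.kd β γ * Toda.oint
        (Toda.zpow (s γ - s' γ + Toda.kd α γ + Toda.kd β γ - 2) *
          Toda.expXiDiff (Sum.inl γ) *
          Toda.inFst (Toda.shift (-1) (Sum.inl γ) (τ α γ s)) *
          Toda.inSnd (Toda.shift 1 (Sum.inl γ) (τ γ β s'))) =
      ∑ γ : Fin N, (-1) ^ Toda.kd α γ * Toda.oint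
        (Toda.zpow (s' γ - s γ - 2) *
          Toda.expXiDiff (Sum.inr γ) *
          Toda.inFst (Toda.shift (-1) (Sum.inr γ) (τ α γ (s + Toda.unitVec γ))) *
          Toda.inSnd (Toda.shift 1 (Sum.inr γ) (τ γ β (s' - Toda.unitVec γ)))) := by
  have : Nonempty (Fin N) := ⟨α⟩
  have h := sub_eq_zero.mp (hW.bilinear_eq_zero hD α β s s')
  -- Both sides become the same multiple of the two pairings, so the tau-functions need not be
  -- cancelled.
  simp only [hτ.oint_eq, hτ.oint_bar_eq, Finset.sum_neg_distrib, ← Finset.mul_sum, Toda.oint_sum]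
  exact congrArg (fun x => -(Toda.tauFactor τ α β s s' * (C (2 * Real.pi * Complex.I) * x))) h
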